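/- **Setting.** Let $d\ge 1$ and $k\geq 1$ be integers, and let $\eta\in(0,d/2]$. *Hölder balls.* $\mathcal H^\eta_A(\mathbb R^k)$ is the set of continuous $f:\mathbb R^k\to\mathbb R$ having (weak, i.e. for the top order almost everywhere defined) bounded partial derivatives up to order $\lfloor\eta\rfloor$ with $$\sum_{|\nu|\le\lfloor\eta\rfloor}\|\partial^\nu f\|_\infty+\sum_{|\nu|=\lfloor\eta\rfloor}\sup_{x\ne y}\frac{|\partial^\nu f(x)-\partial^\nu f(y)|}{\|x-y\|^{\eta-\lfloor\eta\rfloor}}\le A .$$ *Wavelets.* Let $\phi:\mathbb R\to\mathbb R$ be a compactly supported orthonormal scaling function with finite filter $(h_m)_{m\in\mathbb Z}$ (for instance a Daubechies scaling function): $\phi$ is continuous, $\phi(x)=\sqrt2\sum_m h_m\phi(2x-m)$, the integer translates of $\phi$ are orthonormal in $L^2(\mathbb R)$, and $\int\phi=1$. Assume $\phi\in\mathcal H^{d/2+2}_A(\mathbb R)$ for some $A$. Put $\psi_0=\phi$ and $\psi_1(x)=\sqrt2\sum_m(-1)^m h_{2c+1-m}\,\phi(2x-m)$ with a fixed $c\in\mathbb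 Z$. For $j\in\mathbb N$, $\varepsilon\in\{0,1\}^k$, $w\in\mathbb Z^k$ let $$\psi_{j\varepsilon w}(x)=2^{jk/2}\prod_{i=1}^k\psi_{\varepsilon_i}(2^jx_i-w_i),$$ except that $\psi_{j0w}:=0$ for $\varepsilon=0$ and $j\ge1$, and let $\alpha_f(j,\varepsilon,w)=\int f\,\psi_{j\varepsilon w}$. *Approximate wavelets.* For $n\ge1$ let $\hat\phi$ be a function vanishing outside $[-S,S]$ with $\phi-\hat\phi\in\mathcal H^{\lfloor d/2\rfloor+2}_{n^{-1/2}}(\mathbb R)$, and let $\hat\psi_{j\varepsilon w}$ be built from $\hat\phi$, with the same $h$ and $c$, by the same formulas. *Besov norms.* For $s\in\mathbb R$, $b\ge0$, $q_1,q_2\in[1,\infty]$ let $$\|f\|_{\mathcal B^{s,b}_{q_1,q_2}(\mathbb R^k)}=\Big(\sum_{j\ge0}\sum_\varepsilon2^{jq_2(s+k/2-k/q_1)}(1+j)^{bq_2}\Big(\sum_{w}|\alpha_f(j,\varepsilon,w)|^{q_1}\Big)^{q_2/q_1}\Big)^{1/q_2},$$ with $w$ running over $\mathbb Z^k$ (and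 suprema for infinite exponents). The local norm $\|f\|_{\mathcal B^{s,b}_{q_1,q_2}(B^k(0,R))}$ is the same expression with, at each level $j$, $w$ running only over the wavelet locations $\{-R2^j,\dots,R2^j\}^k$. *The class.* Fix $K>1$. Call $C_\eta>0$ admissible if $\|f\|_{\mathcal B^{\eta,0}_{\infty,\infty}(\mathbb R^k)}\le C_\eta$ for all $f\in\mathcal H^\eta_1(\mathbb R^k)$. For $\delta\in(0,1)$ and an integer $R\ge1$, $\hat{\mathcal F}^{k,\eta}_{\delta,R}$ is the set of functions $$\sum_{0\le j\le\log_2(\delta^{-1})}\ \sum_{\varepsilon}\ \sum_{w\in\{-R2^j,\dots,R2^j\}^k}\hat\alpha(j,\varepsilon,w)\,\hat\psi_{j\varepsilon w}\quad\text{with}\quad|\hat\alpha(j,\varepsilon,w)|\le C_\eta K(1+\|w\|)2^{-j(\eta+k/2)} .$$ **Proposition.** An admissible constant $C_\eta$ exists. For every admissible $C_\eta$, every $K>1$, $n\ge 1$, $\hat\phi$, $R\ge1$, $\delta\in(0,1)$ as above and every $f\in\mathcal H^\eta_1(\mathbb R^k)$, the function $$\overline f:=\sum_{0\le j\le\log_2(\delta^{-1})}\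 \sum_{\varepsilon}\ \sum_{w\in\{-R2^j,\dots,R2^j\}^k}\alpha_f(j,\varepsilon,w)\,\hat\psi_{j\varepsilon w}$$ belongs to $\hat{\mathcal F}^{k,\eta}_{\delta,R}$. Moreover, for all $\gamma<\eta$, $b\ge0$, $S\in\mathbb R$ and $\delta_0<1$ there is a constant $C$ (depending only on these and on $d,k,\eta,h,c,\phi$) such that for all $n\ge1$, all $\hat\phi$ as above, all integers $R\ge1$, all $\delta\in(0,1)$ with $\delta\le\delta_0$ (this last restriction is not needed if $b=0$), all $f\in\mathcal H^\eta_1(\mathbb R^k)$ and all $q_1,q_2\in[1,\infty]$, $$\|f-\overline f\|_{\mathcal B^{\gamma,b}_{q_1,q_2}(B^k(0,R))}\le C\,R^{k/q_1}\big(n^{-1/2}+\log(\delta^{-1})^b\,\delta^{\eta-\gamma}\big).$$ -/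

import Mathlib

open MeasureTheory
open scoped ENNReal ContDiff

noncomputable section

/-- `k`-dimensional Euclidean space. -/
abbrev RR (k : ℕ) : Type := EuclideanSpace ℝ (Fin k)

/-! ### Hölder balls -/

/-- Multi-indices `ν` with `|ν| ≤ m`. -/
def multiIndexLE (k m : ℕ) : Finset (Fin k → ℕ) :=
  (Fintype.piFinset fun _ => Finset.range (m + 1)).filter fun ν => ∑ i, ν i ≤ m

/-- Multi-indices `ν` with `|ν| = m`. -/
def multiIndexEq (k m : ℕ) : Finset (Fin k → ℕ) :=
  (Fintype.piFinset fun _ => Finset.range (m + 1)).filter fun ν => ∑ i, ν i = m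

/-- `g` is the (weak) partial derivative of `f` in the `i`-th coordinate direction. For
continuously differentiable or locally Lipschitz `f` this is the classical (a.e.) partial
derivative. -/
def IsWeakPartial {k : ℕ} (i : Fin k) (f g : RR k → ℝ) : Prop :=
  ∀ χ : RR k → ℝ, ContDiff ℝ ∞ χ → HasCompactSupport χ →
    ∫ x, f x * fderiv ℝ χ x (EuclideanSpace.single i 1) = -∫ x, g x * χ x

/-- The seminorm `sup_{x ≠ y} |g x - g y| / ‖x - y‖ ^ s`. -/
def holderSeminorm {k : ℕ} (s : ℝ) (g : RR k → ℝ) : ℝ≥0∞ :=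
  ⨆ (x : RR k) (y : RR k) (_ : x ≠ y), ENNReal.ofReal (|g x - g y| / ‖x - y‖ ^ s)

/-- `f` belongs to the ball of radius `K` of the Hölder space of regularity `η` on `ℝᵏ`:
`f` is continuous, has partial derivatives `D ν` of all orders `|ν| ≤ ⌊η⌋` (those of top order being
defined almost everywhere) and
`∑_{|ν| ≤ ⌊η⌋} ‖D ν‖_∞ + ∑_{|ν| = ⌊η⌋} ‖D ν‖_{η - ⌊η⌋} ≤ K`. -/
def InHolderBall {k : ℕ} (η K : ℝ) (f : RR k → ℝ) : Prop :=
  Continuous f ∧ ∃ D : (Fin k → ℕ) → RR k → ℝ,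
    D 0 = f ∧
    (∀ ν, ∑ i, ν i ≤ ⌊η⌋₊ → MemLp (D ν) ⊤ volume) ∧
    (∀ ν i, ∑ l, ν l < ⌊η⌋₊ → IsWeakPartial i (D ν) (D (ν + Pi.single i 1))) ∧
    ∑ ν ∈ multiIndexLE k ⌊η⌋₊, eLpNorm (D ν) ⊤ volume +
      ∑ ν ∈ multiIndexEq k ⌊η⌋₊, holderSeminorm (η - ⌊η⌋₊) (D ν) ≤ ENNReal.ofReal K

/-- The Hölder ball for functions of one real variable. -/
def InHolderBallReal (η K : ℝ) (f : ℝ → ℝ) : Prop :=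
  InHolderBall (k := 1) η K fun x => f (x 0)

/-! ### Compactly supported orthonormal wavelets -/

/-- `φ` is a compactly supported orthonormal scaling function with (finite) low-pass filter `h`:
it satisfies the two-scale relation `φ(x) = √2 ∑ₘ hₘ φ(2x - m)`, its integer translates are
orthonormal in `L²(ℝ)` and its integral is one. The Daubechies scaling functions are of this
kind. -/
structure IsScalingFunction (h : ℤ →₀ ℝ) (φ : ℝ → ℝ) : Prop where
  continuous : Continuous φ
  hasCompactSupport : HasCompactSupport φ
  twoScale : ∀ x, φ x = √2 * ∑ m ∈ h.support, h m * φ (2 * x - m)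
  orthonormal : ∀ v w : ℤ, ∫ x, φ (x - v) * φ (x - w) = if v = w then 1 else 0
  integral_eq_one : ∫ x, φ x = 1

/-- The wavelet built from a function `φ` with the low-pass filter `h`,
`ψ(x) = √2 ∑ₘ (-1)ᵐ h_{2c+1-m} φ(2x - m)` (written after the substitution `m ↦ 2c + 1 - m`). The
integer `c` fixes the translation convention. It is applied to the exact scaling function, and also
to its approximation. -/
def motherWavelet (h : ℤ →₀ ℝ) (c : ℤ) (φ : ℝ → ℝ) : ℝ → ℝ := fun x =>
  √2 * ∑ m ∈ h.support,
    (-1 : ℝ) ^ (2 * c + 1 - m) * h m * φ (2 * x - ((2 * c + 1 - m : ℤ) : ℝ))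

/-- The tensor wavelets
`ψ_{j,ε,w}(x) = 2^{jk/2} ∏ᵢ ψ_{εᵢ}(2ʲ xᵢ - wᵢ)`, where `ψ_0 = φ` is the scaling function and
`ψ_1` the wavelet built from it; `ε ∈ {0,1}ᵏ` collects the binary digits of the usual index
`l ∈ {1, …, 2ᵏ}`. The index `ε = 0` (pure scaling function, `l = 2ᵏ`) is used at level
`j = 0` only: by convention `ψ_{j,0,w} = 0` for `j ≥ 1`. -/
def tensorWavelet {k : ℕ} (h : ℤ →₀ ℝ) (c : ℤ) (φ : ℝ → ℝ)
    (j : ℕ) (ε : Fin k → Bool) (w : Fin k → ℤ) : RR k → ℝ := fun x =>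
  if j ≠ 0 ∧ ε = fun _ => false then 0
  else (2 : ℝ) ^ ((j : ℝ) * k / 2) *
    ∏ i, (if ε i then motherWavelet h c φ else φ) (2 ^ j * x i - w i)

/-- The wavelet coefficient `α_f(j,ε,w) = ⟨f, ψ_{j,ε,w}⟩`. -/
def waveletCoeff {k : ℕ} (h : ℤ →₀ ℝ) (c : ℤ) (φ : ℝ → ℝ) (f : RR k → ℝ)
    (j : ℕ) (ε : Fin k → Bool) (w : Fin k → ℤ) : ℝ :=
  ∫ x, f x * tensorWavelet h c φ j ε w x

/-- The grid `{-R 2ʲ, …, R 2ʲ}ᵏ`. -/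
def waveletGrid (k R j : ℕ) : Finset (Fin k → ℤ) :=
  Fintype.piFinset fun _ => Finset.Icc (-((R : ℤ) * 2 ^ j)) ((R : ℤ) * 2 ^ j)

/-! ### Besov norms -/

/-- The `ℓ^q` norm of a family of extended nonnegative reals, `1 ≤ q ≤ ∞`. -/
def lqNorm {ι : Type*} (q : ℝ≥0∞) (a : ι → ℝ≥0∞) : ℝ≥0∞ :=
  if q = ⊤ then ⨆ i, a i else (∑' i, a i ^ q.toReal) ^ (1 / q.toReal)

/-- The Besov norm computed from the wavelet coefficients whose location `w` at level `j` belongs to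
`A j`:
`(∑_{j,ε} 2^{j q₂ (s + k/2 - k/q₁)} (1+j)^{b q₂} (∑_{w ∈ A j} |α_f(j,ε,w)|^{q₁})^{q₂/q₁})^{1/q₂}`
(suprema for infinite exponents). The scaling coefficients are the terms `j = 0`, `ε = 0`, which
have weight one. -/
def besovNormOn {k : ℕ} (h : ℤ →₀ ℝ) (c : ℤ) (φ : ℝ → ℝ) (A : ℕ → Set (Fin k → ℤ))
    (s b : ℝ) (q₁ q₂ : ℝ≥0∞) (f : RR k → ℝ) : ℝ≥0∞ :=
  lqNorm q₂ fun p : ℕ × (Fin k → Bool) =>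
    ENNReal.ofReal ((2 : ℝ) ^ ((p.1 : ℝ) * (s + k / 2 - k * (q₁⁻¹).toReal)) * (1 + p.1) ^ b) *
      lqNorm q₁ fun w : A p.1 => ENNReal.ofReal |waveletCoeff h c φ f p.1 p.2 w|

/-- The Besov norm `‖f‖_{B^{s,b}_{q₁,q₂}(ℝᵏ)}`. -/
def besovNorm {k : ℕ} (h : ℤ →₀ ℝ) (c : ℤ) (φ : ℝ → ℝ)
    (s b : ℝ) (q₁ q₂ : ℝ≥0∞) (f : RR k → ℝ) : ℝ≥0∞ :=
  besovNormOn h c φ (fun _ => Set.univ) s b q₁ q₂ f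

/-- The local Besov norm `‖f‖_{B^{s,b}_{q₁,q₂}(Bᵏ(0,R))}`: only the wavelets located over the ball
are taken into account, i.e. those with `w ∈ {-R 2ʲ, …, R 2ʲ}ᵏ`. -/
def besovNormBall {k : ℕ} (h : ℤ →₀ ℝ) (c : ℤ) (φ : ℝ → ℝ) (R : ℕ)
    (s b : ℝ) (q₁ q₂ : ℝ≥0∞) (f : RR k → ℝ) : ℝ≥0∞ :=
  besovNormOn h c φ (fun j => ↑(waveletGrid k R j)) s b q₁ q₂ f

/-- `H^η_1(ℝᵏ)` is contained in the ball of radius `Cη` of `B^η_{∞,∞}(ℝᵏ)`. -/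
def HolderInBesov (k : ℕ) (h : ℤ →₀ ℝ) (c : ℤ) (φ : ℝ → ℝ) (η Cη : ℝ) : Prop :=
  ∀ f : RR k → ℝ, InHolderBall η 1 f → besovNorm h c φ η 0 ⊤ ⊤ f ≤ ENNReal.ofReal Cη

/-! ### Approximate wavelets and the truncated expansion -/

/-- `φ'` approximates the scaling function `φ` with error `n^{-1/2}` in the Hölder norm of
regularity `⌊d/2⌋ + 2`, and vanishes outside `[-S, S]`. -/
structure IsApproxScaling (d n : ℕ) (S : ℝ) (φ φ' : ℝ → ℝ) : Prop where
  close : InHolderBallReal ((d / 2 + 2 : ℕ) : ℝ) ((n : ℝ) ^ (-(1 / 2) : ℝ)) (fun x => φ x - φ' x)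
  support : ∀ x, S < |x| → φ' x = 0

/-- The finest level `⌊log₂(δ⁻¹)⌋`. -/
def maxLevel (δ : ℝ) : ℕ := ⌊Real.logb 2 δ⁻¹⌋₊

/-- The combination
`∑_{j ≤ log₂(δ⁻¹)} ∑_ε ∑_{w ∈ {-R 2ʲ,…,R 2ʲ}ᵏ} a(j,ε,w) ψ_{j,ε,w}` of the wavelets built from
`φ`. -/
def waveletSum {k : ℕ} (h : ℤ →₀ ℝ) (c : ℤ) (φ : ℝ → ℝ) (δ : ℝ) (R : ℕ)
    (a : ℕ → (Fin k → Bool) → (Fin k → ℤ) → ℝ) : RR k → ℝ := fun x =>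
  ∑ j ∈ Finset.range (maxLevel δ + 1), ∑ ε : Fin k → Bool, ∑ w ∈ waveletGrid k R j,
    a j ε w * tensorWavelet h c φ j ε w x

/-- The class of all combinations, up to level `log₂(δ⁻¹)` and over the grids
`{-R 2ʲ, …, R 2ʲ}ᵏ`, of the wavelets built from the approximate scaling function `φ'`, with
coefficients bounded by `Cη K (1 + ‖w‖) 2^{-j(η + k/2)}`. -/
def approxClass (k : ℕ) (h : ℤ →₀ ℝ) (c : ℤ) (φ' : ℝ → ℝ) (η Cη K δ : ℝ) (R : ℕ) :
    Set (RR k → ℝ) :=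
  {g | ∃ a : ℕ → (Fin k → Bool) → (Fin k → ℤ) → ℝ,
    (∀ j ≤ maxLevel δ, ∀ ε, ∀ w ∈ waveletGrid k R j,
      |a j ε w| ≤ Cη * K * (1 + √(∑ i, (w i : ℝ) ^ 2)) * (2 : ℝ) ^ (-((j : ℝ) * (η + k / 2)))) ∧
    g = waveletSum h c φ' δ R a}

/-- The truncated wavelet expansion of `f`: exact coefficients, approximate wavelets. -/
def truncExpansion {k : ℕ} (h : ℤ →₀ ℝ) (c : ℤ) (φ φ' : ℝ → ℝ) (δ : ℝ) (R : ℕ)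
    (f : RR k → ℝ) : RR k → ℝ :=
  waveletSum h c φ' δ R (waveletCoeff h c φ f)

end

/-! The coefficients of $f-\overline f$ against the exact wavelets are bounded one by one, and the
Besov norm is then summed. If $\overline f$ used the exact wavelets, orthonormality would make its
error coefficient at a grid point $w'$ of level $j'$ equal to zero for $j'\le\log_2(\delta^{-1})$
and to $\alpha_f(j',\varepsilon',w')$ beyond. What remains is
$\sum\alpha_f(j,\varepsilon,w)\langle\hat\psi_{j\varepsilon w}-\psi_{j\varepsilon
w},\psi_{j'\varepsilon'w'}\rangle$. The coefficients $\alpha_f$ are $O(2^{-j(\eta+k/2)})$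
(`exists_abs_waveletCoeff_le`). The pairings, summed over $w$, are $O(n^{-1/2}2^{(j-j')k/2})$, with
a further factor $2^{-(j'-j)N}$, $N=\lfloor d/2\rfloor+2$, when $j\le j'$
(`exists_sum_abs_tensor_sub_le`). As $0<\eta<N$, summing over $j$ gives
$O(n^{-1/2}2^{-j'(\eta+k/2)})$ (`exists_abs_waveletCoeff_error_le`). In the Besov norm this leaves
the weights $2^{-j(\eta-\gamma)}(1+j)^b$: their full sum multiplies $n^{-1/2}$, and their tail
beyond $\log_2(\delta^{-1})$ produces $\log(\delta^{-1})^b\delta^{\eta-\gamma}$.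

Both decay estimates rest on `MomentDual`, which is local approximability by polynomials in dual
form. It follows from Hölder regularity by integrating an approximation of the top derivative; weak
derivatives are made classical by mollification, with bounds that do not depend on the mollifier.
Being stable under dilations and finite linear combinations, it passes from $\phi-\hat\phi$ to the
wavelet built from it, so the same estimate serves $\phi$ (size $A$) and $\phi-\hat\phi$ (size
$n^{-1/2}$).

The vanishing moments of $\psi_1$ are not assumed. They are derived from the smoothness of $\phi$
and the orthogonality of $\phi$ to all $\psi_1(2^jx-w)$ (`succ_of_orthogonal`); that orthogonality
is algebra with the filter.

In dimension $k$ a single coordinate with $\varepsilon_i=1$ supplies the decay and the others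
contribute only size bounds. Since the grids are products, sums over $w$ of products over
coordinates factorise. -/

open Filter Topology

/-! ### Vanishing moments and duality with polynomial approximation -/

/-- The moments of `ψ` of order less than `N`, around any point, vanish. -/
def VanishingMoments (N : ℕ) (ψ : ℝ → ℝ) : Prop :=
  ∀ a : ℝ, ∀ l < N, ∫ x, (x - a) ^ l * ψ x = 0

/-- On functions with `N` vanishing moments supported in an interval of radius `r`, the pairing
with `u` is at most `H r ^ s` times the `L¹` norm. -/
def MomentDual (N : ℕ) (s H : ℝ) (u : ℝ → ℝ) : Prop :=
  ∀ (a r : ℝ) (ψ : ℝ → ℝ), 0 < r → Continuous ψ → (∀ x, r < |x - a| → ψ x = 0) →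
    VanishingMoments N ψ → |∫ x, u x * ψ x| ≤ H * r ^ s * ∫ x, |ψ x|

theorem hasCompactSupport_of_radius {a r : ℝ} {ψ : ℝ → ℝ} (h : ∀ x, r < |x - a| → ψ x = 0) :
    HasCompactSupport ψ := by
  refine HasCompactSupport.intro (isCompact_Icc (a := a - r) (b := a + r)) fun x hx => h x ?_
  by_contra hc
  rw [not_lt, abs_le] at hc
  exact hx ⟨by linarith [hc.1], by linarith [hc.2]⟩

/-- Each antiderivative gains one degree and one factor `r`: the primitive of an approximant of the
derivative, with the right value at the centre, approximates the function by the mean value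
inequality. -/
theorem exists_polynomial_approx {p : ℕ} {a r H : ℝ} (hr : 0 ≤ r) (N : ℕ) :
    ∀ {V : ℕ → ℝ → ℝ}, (∀ l < N, ∀ t, HasDerivAt (V l) (V (l + 1) t) t) →
    ∀ {c : ℕ → ℝ}, (∀ t, |t - a| ≤ r → |V N t - ∑ l ∈ Finset.range p, c l * (t - a) ^ l| ≤ H) →
    ∃ c' : ℕ → ℝ, ∀ t, |t - a| ≤ r →
      |V 0 t - ∑ l ∈ Finset.range (N + p), c' l * (t - a) ^ l| ≤ H * r ^ N := by
  induction N with
  | zero => intro V _ c hc; exact ⟨c, by simpa using hc⟩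
  | succ N ih =>
    intro V hV c hc
    obtain ⟨c', hc'⟩ := ih (V := fun l => V (l + 1)) (fun l hl t => hV (l + 1) (by omega) t) hc
    -- Coefficients of the primitive of the approximant for `V 1`, with constant term `V 0 a`.
    refine ⟨fun l => if l = 0 then V 0 a else c' (l - 1) / l, fun t ht => ?_⟩
    have hB : 0 ≤ H * r ^ N := (abs_nonneg _).trans (hc' t ht)
    set g : ℝ → ℝ := fun t =>
      V 0 t - ∑ l ∈ Finset.range (N + p), c' l / ((l + 1 : ℕ) : ℝ) * (t - a) ^ (l + 1) with hg
    have hgd : ∀ t, HasDerivAt g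
        (V 1 t - ∑ l ∈ Finset.range (N + p), c' l * (t - a) ^ l) t := by
      intro t
      refine (hV 0 (by omega) t).sub (HasDerivAt.fun_sum fun l _ => ?_)
      have h1 := (((hasDerivAt_id t).sub_const a).pow (l + 1)).const_mul
        (c' l / ((l + 1 : ℕ) : ℝ))
      refine h1.congr_deriv ?_
      have : ((l + 1 : ℕ) : ℝ) ≠ 0 := by positivity
      rw [Nat.add_sub_cancel, mul_one, ← mul_assoc, div_mul_cancel₀ _ this]
      rfl
    have hmv := (convex_Icc (a - r) (a + r)).norm_image_sub_le_of_norm_hasDerivWithin_le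
      (f := g) (C := H * r ^ N) (x := a) (y := t) (fun x _ => (hgd x).hasDerivWithinAt)
      (fun x hx => hc' x (abs_le.2 ⟨by linarith [hx.1], by linarith [hx.2]⟩))
      ⟨by linarith, by linarith⟩
      ⟨by linarith [(abs_le.1 ht).1], by linarith [(abs_le.1 ht).2]⟩
    have hga : g a = V 0 a := by simp [hg]
    have hsum : ∑ l ∈ Finset.range (N + 1 + p),
        (if l = 0 then V 0 a else c' (l - 1) / l) * (t - a) ^ l =
        ∑ l ∈ Finset.range (N + p), c' l / ((l + 1 : ℕ) : ℝ) * (t - a) ^ (l + 1) + V 0 a := by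
      rw [show N + 1 + p = N + p + 1 by ring, Finset.sum_range_succ']
      simp
    rw [hsum]
    rw [hga, Real.norm_eq_abs, Real.norm_eq_abs] at hmv
    calc _ = |g t - V 0 a| := by simp only [hg]; congr 1; abel
      _ ≤ H * r ^ N * |t - a| := hmv
      _ ≤ H * r ^ N * r := by gcongr
      _ = _ := by ring

/-- The approximating polynomial is invisible to `ψ`, so it may be subtracted from `u` before taking
absolute values. -/
theorem abs_integral_mul_le_of_polynomial_approx {M : ℕ} {a r B : ℝ} {u ψ : ℝ → ℝ} {c : ℕ → ℝ}
    (hu : Continuous u) (hψ : Continuous ψ) (hsupp : ∀ x, r < |x - a| → ψ x = 0)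
    (hmom : VanishingMoments M ψ)
    (hc : ∀ t, |t - a| ≤ r → |u t - ∑ l ∈ Finset.range M, c l * (t - a) ^ l| ≤ B) :
    |∫ x, u x * ψ x| ≤ B * ∫ x, |ψ x| := by
  have hcs := hasCompactSupport_of_radius hsupp
  have hI : ∀ v : ℝ → ℝ, Continuous v → Integrable fun x => v x * ψ x := fun v hv =>
    (hv.mul hψ).integrable_of_hasCompactSupport hcs.mul_left
  have hP : ∫ x, (∑ l ∈ Finset.range M, c l * (x - a) ^ l) * ψ x = 0 := by
    simp_rw [Finset.sum_mul, mul_assoc]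
    rw [integral_finsetSum]
    · refine Finset.sum_eq_zero fun l hl => ?_
      rw [integral_const_mul, hmom a l (Finset.mem_range.1 hl), mul_zero]
    · exact fun l _ => (hI _ (by fun_prop)).const_mul _
  have hsub : ∫ x, u x * ψ x =
      ∫ x, (u x - ∑ l ∈ Finset.range M, c l * (x - a) ^ l) * ψ x := by
    simp_rw [sub_mul]
    rw [integral_sub (hI u hu) (hI _ (by fun_prop)), hP, sub_zero]
  rw [hsub, ← integral_const_mul]
  refine abs_integral_le_integral_abs.trans (integral_mono_of_nonneg
    (Eventually.of_forall fun x => abs_nonneg _)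
    ((hψ.integrable_of_hasCompactSupport hcs).abs.const_mul _)
    (Eventually.of_forall fun x => ?_))
  simp only [abs_mul]
  rcases le_or_gt |x - a| r with h | h
  · exact mul_le_mul_of_nonneg_right (hc x h) (abs_nonneg _)
  · simp [hsupp x h]

theorem abs_integral_mul_le_of_tendsto {u ψ : ℝ → ℝ} {v : ℕ → ℝ → ℝ} {B K : ℝ}
    (hψ : Continuous ψ) (hcs : HasCompactSupport ψ) (hv : ∀ n, Continuous (v n))
    (hK : ∀ n x, |v n x| ≤ K) (hlim : ∀ x, Tendsto (fun n => v n x) atTop (𝓝 (u x)))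
    (hB : ∀ n, |∫ x, v n x * ψ x| ≤ B) : |∫ x, u x * ψ x| ≤ B := by
  have hconv : Tendsto (fun n => ∫ x, v n x * ψ x) atTop (𝓝 (∫ x, u x * ψ x)) := by
    refine tendsto_integral_of_dominated_convergence (fun x => K * |ψ x|)
      (fun n => ((hv n).mul hψ).aestronglyMeasurable)
      ((hψ.integrable_of_hasCompactSupport hcs).abs.const_mul _)
      (fun n => Eventually.of_forall fun x => ?_)
      (Eventually.of_forall fun x => (hlim x).mul_const _)
    rw [Real.norm_eq_abs, abs_mul]
    exact mul_le_mul_of_nonneg_right (hK n x) (abs_nonneg _)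
  exact le_of_tendsto hconv.abs (Eventually.of_forall hB)

/-! ### Mollification of weakly differentiable functions -/

section Mollify

variable {k : ℕ}

/-- Convolution with a normalised bump function. -/
noncomputable def mollify (ρ : ContDiffBump (0 : RR k)) (g : RR k → ℝ) (x : RR k) : ℝ :=
  ∫ y, ρ.normed volume y * g (x - y)

theorem mollify_eq_convolution (ρ : ContDiffBump (0 : RR k)) (g : RR k → ℝ) :
    mollify ρ g = MeasureTheory.convolution (ρ.normed volume) g
      (ContinuousLinearMap.lsmul ℝ ℝ) volume := by
  ext x; simp [mollify, MeasureTheory.convolution_def]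

theorem MeasureTheory.MemLp.locallyIntegrable_of_top {g : RR k → ℝ} (hg : MemLp g ⊤ volume) :
    LocallyIntegrable g volume := hg.locallyIntegrable le_top

theorem integrable_normed_mul (ρ : ContDiffBump (0 : RR k)) {g : RR k → ℝ}
    (hg : MemLp g ⊤ volume) (x : RR k) :
    Integrable fun y => ρ.normed volume y * g (x - y) := by
  have h1 : Integrable (ρ.normed volume) volume := ρ.integrable_normed
  have h2 : MemLp (fun y => g (x - y)) ⊤ volume :=
    hg.comp_measurePreserving (Measure.measurePreserving_sub_left volume x)
  exact h1.mul_of_top_left h2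

theorem abs_mollify_le (ρ : ContDiffBump (0 : RR k)) {g : RR k → ℝ} {H : ℝ}
    (hg : ∀ᵐ x, |g x| ≤ H) (x : RR k) : |mollify ρ g x| ≤ H := by
  have h2 : ∀ᵐ y, |g (x - y)| ≤ H :=
    (Measure.measurePreserving_sub_left volume x).quasiMeasurePreserving.ae hg
  calc |mollify ρ g x| ≤ ∫ y, ρ.normed volume y * H := by
        refine abs_integral_le_integral_abs.trans (integral_mono_of_nonneg
          (Eventually.of_forall fun x => abs_nonneg _) (ρ.integrable_normed.mul_const _) ?_)
        filter_upwards [h2] with y hy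
        simp only [abs_mul, abs_of_nonneg (ρ.nonneg_normed y)]
        exact mul_le_mul_of_nonneg_left hy (ρ.nonneg_normed y)
    _ = H := by rw [integral_mul_const, ρ.integral_normed, one_mul]

theorem abs_mollify_sub_le (ρ : ContDiffBump (0 : RR k)) {g : RR k → ℝ} {H s : ℝ}
    (hg : MemLp g ⊤ volume) (hH : ∀ x y, |g x - g y| ≤ H * ‖x - y‖ ^ s) (x z : RR k) :
    |mollify ρ g x - mollify ρ g z| ≤ H * ‖x - z‖ ^ s := by
  rw [mollify, mollify, ← integral_sub (integrable_normed_mul ρ hg x)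
    (integrable_normed_mul ρ hg z)]
  calc _ ≤ ∫ y, ρ.normed volume y * (H * ‖x - z‖ ^ s) := by
        refine abs_integral_le_integral_abs.trans (integral_mono_of_nonneg
          (Eventually.of_forall fun x => abs_nonneg _) (ρ.integrable_normed.mul_const _)
          (Eventually.of_forall fun y => ?_))
        simp only [← mul_sub, abs_mul, abs_of_nonneg (ρ.nonneg_normed y)]
        refine mul_le_mul_of_nonneg_left ?_ (ρ.nonneg_normed y)
        simpa using hH (x - y) (z - y)
    _ = _ := by rw [integral_mul_const, ρ.integral_normed, one_mul]

/-- The derivative falls on the bump, and the weak derivative relation carries it over to `g`. This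
gives genuine derivatives along every line, although `g'` is determined only almost everywhere. -/
theorem hasDerivAt_mollify_line (ρ : ContDiffBump (0 : RR k)) {g g' : RR k → ℝ} {i : Fin k}
    (hg : MemLp g ⊤ volume) (hw : IsWeakPartial i g g') (x : RR k) (t : ℝ) :
    HasDerivAt (fun t : ℝ => mollify ρ g (x + t • EuclideanSpace.single i (1 : ℝ)))
      (mollify ρ g' (x + t • EuclideanSpace.single i (1 : ℝ))) t := by
  set e : RR k := EuclideanSpace.single i (1 : ℝ)
  have hcs : HasCompactSupport (ρ.normed volume) := ρ.hasCompactSupport_normed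
  have hsm : ContDiff ℝ ∞ (ρ.normed volume) := ρ.contDiff_normed
  have hsm1 : ContDiff ℝ 1 (ρ.normed volume) := ρ.contDiff_normed
  have h1 := hcs.hasFDerivAt_convolution_left (ContinuousLinearMap.lsmul ℝ ℝ) (μ := volume) hsm1
    hg.locallyIntegrable_of_top (x + t • e)
  rw [← mollify_eq_convolution] at h1
  have h2 : HasDerivAt (fun t : ℝ => x + t • e) e t := by
    simpa using ((hasDerivAt_id t).smul_const e).const_add x
  have h3 := h1.comp_hasDerivAt t h2
  set z := x + t • e
  refine h3.congr_deriv ?_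
  have hint : Integrable (fun y => ((ContinuousLinearMap.lsmul ℝ ℝ).precompL (RR k)
      (fderiv ℝ (ρ.normed volume) y)) (g (z - y))) volume :=
    ((hcs.fderiv (𝕜 := ℝ)).convolutionExists_left _
      (hsm1.continuous_fderiv one_ne_zero) hg.locallyIntegrable_of_top z)
  rw [MeasureTheory.convolution_def, ContinuousLinearMap.integral_apply hint]
  -- The test function is the reflected bump centred at `z`; the sign from the reflection cancels
  -- the sign of integration by parts.
  have hχ := hw (fun y => ρ.normed volume (z - y))
    (hsm.comp (contDiff_const.sub contDiff_id))
    (hcs.comp_homeomorph (Homeomorph.subLeft z))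
  have hfd : ∀ y, fderiv ℝ (fun y => ρ.normed volume (z - y)) y e =
      -(fderiv ℝ (ρ.normed volume) (z - y) e) := by
    intro y
    have h4 : HasFDerivAt (fun y : RR k => z - y) (-ContinuousLinearMap.id ℝ (RR k)) y := by
      simpa using (hasFDerivAt_id y).const_sub z
    have h5 := ((hsm1.differentiable one_ne_zero) (z - y)).hasFDerivAt.comp y h4
    have h6 : fderiv ℝ (fun y => ρ.normed volume (z - y)) y = _ := h5.fderiv
    rw [h6]; simp
  simp only [e] at hfd hχ
  simp_rw [hfd] at hχ
  have hR : mollify ρ g' z = ∫ y, g' y * ρ.normed volume (z - y) := by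
    rw [mollify, ← integral_sub_left_eq_self _ volume z]
    simp [mul_comm]
  rw [hR, ← neg_eq_iff_eq_neg.2 hχ, ← integral_neg,
    ← integral_sub_left_eq_self _ volume z]
  refine integral_congr_ae (Eventually.of_forall fun y => ?_)
  simp [e, mul_comm]

theorem continuous_mollify (ρ : ContDiffBump (0 : RR k)) {g : RR k → ℝ}
    (hg : MemLp g ⊤ volume) : Continuous (mollify ρ g) := by
  rw [mollify_eq_convolution]
  exact ρ.hasCompactSupport_normed.continuous_convolution_left _ ρ.continuous_normed
    hg.locallyIntegrable_of_top

/-- Weak derivatives up to order `N`, the last of which is, after mollification, close to a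
polynomial of degree less than `p`, give duality with functions with vanishing moments. -/
theorem abs_integral_line_le {i : Fin k} {N p : ℕ} {D : ℕ → RR k → ℝ} {H a r : ℝ} {ψ : ℝ → ℝ}
    (hcont : Continuous (D 0)) (hmem : ∀ l ≤ N, MemLp (D l) ⊤ volume)
    (hw : ∀ l < N, IsWeakPartial i (D l) (D (l + 1))) (x : RR k) (hr : 0 ≤ r)
    (hψ : Continuous ψ) (hsupp : ∀ t, r < |t - a| → ψ t = 0) (hmom : VanishingMoments (N + p) ψ)
    (hN : ∀ ρ : ContDiffBump (0 : RR k), ∃ c : ℕ → ℝ, ∀ t, |t - a| ≤ r →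
      |mollify ρ (D N) (x + t • EuclideanSpace.single i (1 : ℝ)) -
        ∑ l ∈ Finset.range p, c l * (t - a) ^ l| ≤ H) :
    |∫ t, D 0 (x + t • EuclideanSpace.single i (1 : ℝ)) * ψ t| ≤ H * r ^ N * ∫ t, |ψ t| := by
  set e : RR k := EuclideanSpace.single i (1 : ℝ)
  -- Bumps of radius `1 / (n + 1)`. The bound for the mollified function does not depend on `n`, so
  -- it survives the limit.
  let ρ : ℕ → ContDiffBump (0 : RR k) := fun n =>
    ⟨1 / ((n : ℝ) + 1) / 2, 1 / ((n : ℝ) + 1), by positivity,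
      half_lt_self Nat.one_div_pos_of_nat⟩
  have hρ : Tendsto (fun n => (ρ n).rOut) atTop (𝓝 0) := tendsto_one_div_add_atTop_nhds_zero_nat
  have hline : Continuous fun t : ℝ => x + t • e := by fun_prop
  have hbd : ∀ᵐ y, |D 0 y| ≤ (eLpNorm (D 0) ⊤ volume).toReal := by
    have hfin := (hmem 0 (Nat.zero_le _)).2.ne
    filter_upwards [ae_le_eLpNormEssSup (f := D 0) (μ := volume)] with y hy
    rw [eLpNorm_exponent_top] at hfin ⊢
    have := ENNReal.toReal_mono hfin hy
    simpa using this
  refine abs_integral_mul_le_of_tendsto (v := fun n t => mollify (ρ n) (D 0) (x + t • e)) hψ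
    (hasCompactSupport_of_radius hsupp)
    (fun n => (continuous_mollify _ (hmem 0 (Nat.zero_le _))).comp hline)
    (fun n t => abs_mollify_le _ hbd _) (fun t => ?_) fun n => ?_
  · simp_rw [mollify_eq_convolution]
    exact ContDiffBump.convolution_tendsto_right_of_continuous hρ hcont _
  · obtain ⟨c, hc⟩ := hN (ρ n)
    obtain ⟨c', hc'⟩ := exists_polynomial_approx hr N
      (V := fun l t => mollify (ρ n) (D l) (x + t • e))
      (fun l hl t => hasDerivAt_mollify_line _ (hmem l hl.le) (hw l hl) x t) hc
    exact abs_integral_mul_le_of_polynomial_approx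
      ((continuous_mollify _ (hmem 0 (Nat.zero_le _))).comp hline) hψ hsupp hmom hc'

end Mollify

/-! ### Hölder balls -/

section Holder

variable {k : ℕ} {η K : ℝ} {f : RR k → ℝ}

theorem ae_abs_le_of_eLpNorm_top_le {g : RR k → ℝ} (hK : 0 ≤ K)
    (hg : eLpNorm g ⊤ volume ≤ ENNReal.ofReal K) : ∀ᵐ x, |g x| ≤ K := by
  rw [eLpNorm_exponent_top] at hg
  filter_upwards [ae_le_eLpNormEssSup (f := g) (μ := volume)] with x hx
  have h := hx.trans hg
  rw [← ofReal_norm, ENNReal.ofReal_le_ofReal_iff hK, Real.norm_eq_abs] at h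
  exact h

theorem abs_le_of_ae_abs_le {g : RR k → ℝ} (hg : Continuous g) (h : ∀ᵐ x, |g x| ≤ K) (x : RR k) :
    |g x| ≤ K := by
  by_contra hx
  have ho : IsOpen {x | K < |g x|} := isOpen_lt continuous_const hg.abs
  have hz : volume {x | K < |g x|} = 0 := by
    rw [ae_iff] at h
    simpa using h
  have := ho.eq_empty_of_measure_zero hz
  exact (this ▸ (not_le.1 hx : x ∈ {x | K < |g x|}) : x ∈ (∅ : Set (RR k)))

theorem abs_sub_le_of_holderSeminorm_le {s : ℝ} {g : RR k → ℝ} (hK : 0 ≤ K)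
    (hg : holderSeminorm s g ≤ ENNReal.ofReal K) (x y : RR k) :
    |g x - g y| ≤ K * ‖x - y‖ ^ s := by
  rcases eq_or_ne x y with rfl | hxy
  · simp only [sub_self, abs_zero]
    positivity
  · have h1 : ENNReal.ofReal (|g x - g y| / ‖x - y‖ ^ s) ≤ holderSeminorm s g :=
      le_iSup_of_le x (le_iSup_of_le y (le_iSup_of_le hxy le_rfl))
    have h2 := (ENNReal.ofReal_le_ofReal_iff hK).1 (h1.trans hg)
    have : 0 < ‖x - y‖ ^ s := Real.rpow_pos_of_pos (norm_pos_iff.2 (sub_ne_zero.2 hxy)) _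
    rwa [div_le_iff₀ this] at h2

/-- The pure derivatives in one direction of an element of a Hölder ball. -/
theorem InHolderBall.exists_pure_derivatives (hf : InHolderBall η K f) (hK : 0 ≤ K) (i : Fin k) :
    Continuous f ∧ ∃ D : ℕ → RR k → ℝ, D 0 = f ∧ (∀ l ≤ ⌊η⌋₊, MemLp (D l) ⊤ volume) ∧
      (∀ l < ⌊η⌋₊, IsWeakPartial i (D l) (D (l + 1))) ∧
      (∀ l ≤ ⌊η⌋₊, ∀ᵐ x, |D l x| ≤ K) ∧
      ∀ x y, |D ⌊η⌋₊ x - D ⌊η⌋₊ y| ≤ K * ‖x - y‖ ^ (η - ⌊η⌋₊) := by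
  obtain ⟨hc, D, hD0, hmem, hw, hsum⟩ := hf
  have hs : ∀ l : ℕ, ∑ j, (Pi.single i l : Fin k → ℕ) j = l := fun l => by simp
  have hle : ∀ l : ℕ, ∀ j, (Pi.single i l : Fin k → ℕ) j ≤ l := fun l j => by
    rcases eq_or_ne j i with rfl | h
    · simp
    · simp [h]
  refine ⟨hc, fun l => D (Pi.single i l), by simpa using hD0,
    fun l hl => hmem _ ((hs l).le.trans hl), fun l hl => ?_, fun l hl => ?_, ?_⟩
  · have := hw (Pi.single i l) i ((hs l).trans_lt hl)
    rwa [← Pi.single_add] at this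
  · refine ae_abs_le_of_eLpNorm_top_le hK (le_trans ?_ (le_self_add.trans hsum))
    refine Finset.single_le_sum (f := fun ν => eLpNorm (D ν) ⊤ volume) (fun _ _ => zero_le) ?_
    simp only [multiIndexLE, Finset.mem_filter, Fintype.mem_piFinset, Finset.mem_range, hs]
    exact ⟨fun j => by have := hle l j; omega, hl⟩
  · refine abs_sub_le_of_holderSeminorm_le hK (le_trans ?_ (le_add_self.trans hsum))
    refine Finset.single_le_sum (f := fun ν => holderSeminorm (η - ⌊η⌋₊) (D ν))
      (fun _ _ => zero_le) ?_
    simp only [multiIndexEq, Finset.mem_filter, Fintype.mem_piFinset, Finset.mem_range, hs]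
    exact ⟨fun j => by have := hle ⌊η⌋₊ j; omega, trivial⟩

theorem InHolderBall.abs_le (hf : InHolderBall η K f) (hK : 0 ≤ K) (x : RR k) : |f x| ≤ K := by
  obtain ⟨hc, D, hD0, hmem, hw, hsum⟩ := hf
  refine abs_le_of_ae_abs_le hc (ae_abs_le_of_eLpNorm_top_le hK
    (le_trans ?_ (le_self_add.trans hsum))) x
  rw [← hD0]
  refine Finset.single_le_sum (f := fun ν => eLpNorm (D ν) ⊤ volume) (fun _ _ => zero_le) ?_
  simp [multiIndexLE]

/-- Here the derivative of order `N` is only bounded, so it is approximated by zero (`p = 0`). -/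
theorem InHolderBall.momentDual_line_nat (hf : InHolderBall η K f) (hK : 0 ≤ K) {N : ℕ}
    (hN : N ≤ ⌊η⌋₊) (i : Fin k) (x : RR k) :
    MomentDual N N K fun t => f (x + t • EuclideanSpace.single i (1 : ℝ)) := by
  obtain ⟨hc, D, rfl, hmem, hw, hb, -⟩ := hf.exists_pure_derivatives hK i
  intro a r ψ hr hψ hsupp hmom
  rw [Real.rpow_natCast]
  refine abs_integral_line_le (p := 0) hc (fun l hl => hmem l (hl.trans hN))
    (fun l hl => hw l (hl.trans_le hN)) x hr.le hψ hsupp hmom fun ρ => ⟨fun _ => 0, fun t _ => ?_⟩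
  simpa using abs_mollify_le ρ (hb N hN) _

/-- The Hölder condition lets the derivative of order `⌊η⌋` be replaced by its mollified value at
the centre, at cost `K r ^ (η - ⌊η⌋)`. This constant (`p = 1`) accounts for the extra vanishing
moment. -/
theorem InHolderBall.momentDual_line (hf : InHolderBall η K f) (hη : 0 ≤ η) (hK : 0 ≤ K)
    (i : Fin k) (x : RR k) :
    MomentDual (⌊η⌋₊ + 1) η K fun t => f (x + t • EuclideanSpace.single i (1 : ℝ)) := by
  obtain ⟨hc, D, rfl, hmem, hw, -, hh⟩ := hf.exists_pure_derivatives hK i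
  intro a r ψ hr hψ hsupp hmom
  set e : RR k := EuclideanSpace.single i (1 : ℝ)
  have hfl : 0 ≤ η - ⌊η⌋₊ := sub_nonneg.2 (Nat.floor_le hη)
  have hsplit : K * r ^ η = K * r ^ (η - ⌊η⌋₊) * r ^ ⌊η⌋₊ := by
    rw [mul_assoc, ← Real.rpow_natCast, ← Real.rpow_add hr, sub_add_cancel]
  rw [hsplit]
  refine abs_integral_line_le (p := 1) hc hmem hw x hr.le hψ hsupp hmom fun ρ =>
    ⟨fun _ => mollify ρ (D ⌊η⌋₊) (x + a • e), fun t ht => ?_⟩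
  have h1 := abs_mollify_sub_le ρ (hmem _ le_rfl) hh (x + t • e) (x + a • e)
  have h2 : ‖x + t • e - (x + a • e)‖ = |t - a| := by
    rw [add_sub_add_left_eq_sub, ← sub_smul, norm_smul]
    simp [e]
  rw [h2] at h1
  simpa using h1.trans (by gcongr)

theorem InHolderBallReal.momentDual {θ : ℝ → ℝ} (hθ : InHolderBallReal η K θ) (hK : 0 ≤ K)
    {N : ℕ} (hN : N ≤ ⌊η⌋₊) : MomentDual N N K θ := by
  simpa using hθ.momentDual_line_nat hK hN 0 0

theorem InHolderBallReal.abs_le {θ : ℝ → ℝ} (hθ : InHolderBallReal η K θ) (hK : 0 ≤ K) (x : ℝ) :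
    |θ x| ≤ K := by
  simpa using InHolderBall.abs_le hθ hK (EuclideanSpace.single 0 x)

theorem InHolderBallReal.continuous {θ : ℝ → ℝ} (hθ : InHolderBallReal η K θ) :
    Continuous θ := by
  have h : Continuous fun x : ℝ => (fun y : RR 1 => θ (y 0)) (EuclideanSpace.single 0 x) := by
    refine hθ.1.comp ?_
    have : (EuclideanSpace.single (0 : Fin 1) : ℝ → RR 1) =
        fun x : ℝ => x • EuclideanSpace.single (0 : Fin 1) (1 : ℝ) := by
      ext x; simp
    rw [this]
    fun_prop
  simpa using h

end Holder

/-! ### One-dimensional wavelets: size, support, orthogonality -/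

theorem integral_comp_mul_sub (F : ℝ → ℝ) (a t : ℝ) :
    ∫ x, F (a * x - t) = |a⁻¹| * ∫ x, F x := by
  rw [Measure.integral_comp_mul_left (fun y => F (y - t)) a, integral_sub_right_eq_self,
    smul_eq_mul]

theorem integral_comp_two_pow_mul_sub (F : ℝ → ℝ) (j : ℕ) (t : ℝ) :
    ∫ x, F (2 ^ j * x - t) = (2 ^ j : ℝ)⁻¹ * ∫ x, F x := by
  rw [integral_comp_mul_sub, abs_of_pos (by positivity)]

theorem VanishingMoments.comp_mul_sub {N : ℕ} {ψ : ℝ → ℝ} (hψ : VanishingMoments N ψ) {a : ℝ}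
    (ha : a ≠ 0) (t : ℝ) : VanishingMoments N fun x => ψ (a * x - t) := by
  intro b l hl
  have h : ∫ x, (fun y => (a⁻¹) ^ l * ((y - (a * b - t)) ^ l * ψ y)) (a * x - t) = 0 := by
    rw [integral_comp_mul_sub (fun y => (a⁻¹) ^ l * ((y - (a * b - t)) ^ l * ψ y)) a t,
      integral_const_mul, hψ _ l hl, mul_zero, mul_zero]
  rw [← h]
  refine integral_congr_ae (Eventually.of_forall fun x => ?_)
  have : x - b = a⁻¹ * (a * x - t - (a * b - t)) := by field_simp; ring
  simp only [this, mul_pow]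
  ring

theorem VanishingMoments.mono {M N : ℕ} {ψ : ℝ → ℝ} (hψ : VanishingMoments N ψ) (h : M ≤ N) :
    VanishingMoments M ψ := fun a l hl => hψ a l (hl.trans_le h)

/-- The function `θ` for `e = false`, the wavelet built from it for `e = true`. -/
noncomputable def generator (h : ℤ →₀ ℝ) (c : ℤ) (θ : ℝ → ℝ) (e : Bool) : ℝ → ℝ :=
  if e then motherWavelet h c θ else θ

/-- A radius for the support of the wavelet built from a function supported in `[-T, T]`. -/
noncomputable def generatorRadius (h : ℤ →₀ ℝ) (c : ℤ) (T : ℝ) : ℝ :=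
  T + ∑ m ∈ h.support, |((2 * c + 1 - m : ℤ) : ℝ)|

theorem le_generatorRadius (h : ℤ →₀ ℝ) (c : ℤ) (T : ℝ) : T ≤ generatorRadius h c T :=
  le_add_of_nonneg_right (Finset.sum_nonneg fun _ _ => abs_nonneg _)

section Generator

variable {h : ℤ →₀ ℝ} {c : ℤ} {θ : ℝ → ℝ} {T : ℝ}

theorem continuous_generator (hθ : Continuous θ) (e : Bool) :
    Continuous (generator h c θ e) := by
  cases e
  · exact hθ
  · change Continuous (motherWavelet h c θ)
    unfold motherWavelet
    fun_prop

theorem generator_eq_zero (hT : 0 ≤ T) (hθ : ∀ x, T < |x| → θ x = 0) (e : Bool) {x : ℝ}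
    (hx : generatorRadius h c T < |x|) : generator h c θ e x = 0 := by
  have hTx : T < |x| := (le_generatorRadius h c T).trans_lt hx
  cases e
  · exact hθ x hTx
  · change motherWavelet h c θ x = 0
    rw [motherWavelet, Finset.sum_eq_zero, mul_zero]
    intro m hm
    rw [hθ, mul_zero]
    have h1 : |((2 * c + 1 - m : ℤ) : ℝ)| ≤ ∑ m ∈ h.support, |((2 * c + 1 - m : ℤ) : ℝ)| :=
      Finset.single_le_sum (f := fun m : ℤ => |((2 * c + 1 - m : ℤ) : ℝ)|)
        (fun _ _ => abs_nonneg _) hm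
    have h2 := abs_sub_abs_le_abs_sub (2 * x) ((2 * c + 1 - m : ℤ) : ℝ)
    rw [abs_mul, abs_two] at h2
    rw [generatorRadius] at hx
    linarith

theorem generator_sub (θ₁ θ₂ : ℝ → ℝ) (e : Bool) (x : ℝ) :
    generator h c (fun y => θ₁ y - θ₂ y) e x = generator h c θ₁ e x - generator h c θ₂ e x := by
  cases e
  · rfl
  · simp only [generator, reduceIte, motherWavelet, mul_sub, Finset.sum_sub_distrib]

end Generator

theorem neg_one_zpow_eq_neg_of_odd {a b : ℤ} (hab : Odd (a + b)) :
    (-1 : ℝ) ^ a = -(-1 : ℝ) ^ b := by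
  rcases Int.even_or_odd a with ha | ha
  · have hb : Odd b := by
      rcases Int.even_or_odd b with hb | hb
      · exact absurd (ha.add hb) (Int.not_even_iff_odd.2 hab)
      · exact hb
    rw [ha.neg_one_zpow, hb.neg_one_zpow, neg_neg]
  · have hb : Even b := by
      rcases Int.even_or_odd b with hb | hb
      · exact hb
      · exact absurd (ha.add_odd hb) (Int.not_even_iff_odd.2 hab)
    rw [ha.neg_one_zpow, hb.neg_one_zpow]

namespace IsScalingFunction

variable {h : ℤ →₀ ℝ} {φ : ℝ → ℝ}

theorem integrable_comp_mul (hφ : IsScalingFunction h φ) (g : ℝ → ℝ) (hg : Continuous g) (j : ℕ)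
    (t : ℝ) : Integrable fun x => φ (2 ^ j * x - t) * g x := by
  have h1 : HasCompactSupport fun x : ℝ => φ (2 ^ j * x - t) := by
    have h2 := hφ.hasCompactSupport.comp_homeomorph
      ((Homeomorph.mulLeft₀ (2 ^ j : ℝ) (by positivity)).trans (Homeomorph.subRight t))
    exact h2
  have := hφ.continuous
  exact Continuous.integrable_of_hasCompactSupport (by fun_prop) h1.mul_right

/-- Reduces inner products of functions of the next finer scale to sums over the filter; the factor
`2` from `√2 * √2` cancels the Jacobian. -/
theorem integral_combination (hφ : IsScalingFunction h φ) (s : Finset ℤ) (a b : ℤ → ℝ)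
    (p q : ℤ → ℤ) :
    ∫ x, (√2 * ∑ m ∈ s, a m * φ (2 * x - p m)) * (√2 * ∑ m ∈ s, b m * φ (2 * x - q m)) =
      ∑ m ∈ s, ∑ m' ∈ s, a m * b m' * if p m = q m' then 1 else 0 := by
  have h0 := hφ.continuous
  have hint : ∀ v w : ℤ, Integrable fun x => φ (2 * x - v) * φ (2 * x - w) := fun v w => by
    simpa using hφ.integrable_comp_mul (fun x => φ (2 * x - w)) (by fun_prop) 1 v
  have hval : ∀ v w : ℤ, ∫ x, φ (2 * x - v) * φ (2 * x - w) = 2⁻¹ * if v = w then 1 else 0 := by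
    intro v w
    have := integral_comp_two_pow_mul_sub (fun y => φ (y - v) * φ (y - w)) 1 0
    simpa [hφ.orthonormal] using this
  have hexp : ∀ x, (√2 * ∑ m ∈ s, a m * φ (2 * x - p m)) *
      (√2 * ∑ m ∈ s, b m * φ (2 * x - q m)) =
      ∑ m ∈ s, ∑ m' ∈ s, 2 * (a m * b m') * (φ (2 * x - p m) * φ (2 * x - q m')) := by
    intro x
    rw [mul_mul_mul_comm, Real.mul_self_sqrt zero_le_two, Finset.sum_mul_sum, Finset.mul_sum]
    refine Finset.sum_congr rfl fun m _ => ?_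
    rw [Finset.mul_sum]
    exact Finset.sum_congr rfl fun m' _ => by ring
  simp_rw [hexp]
  rw [integral_finsetSum _ fun m _ => integrable_finsetSum _ fun m' _ => (hint _ _).const_mul _]
  refine Finset.sum_congr rfl fun m _ => ?_
  rw [integral_finsetSum _ fun m' _ => (hint _ _).const_mul _]
  refine Finset.sum_congr rfl fun m' _ => ?_
  rw [integral_const_mul, hval]
  ring

theorem twoScale_translate (hφ : IsScalingFunction h φ) (w : ℤ) (x : ℝ) :
    φ (x - w) = √2 * ∑ m ∈ h.support, h m * φ (2 * x - ((2 * w + m : ℤ) : ℝ)) := by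
  rw [hφ.twoScale]
  congr 1
  refine Finset.sum_congr rfl fun m _ => ?_
  push_cast
  ring_nf

theorem _root_.motherWavelet_translate (h : ℤ →₀ ℝ) (c : ℤ) (φ : ℝ → ℝ) (w : ℤ) (x : ℝ) :
    motherWavelet h c φ (x - w) = √2 * ∑ m ∈ h.support,
      ((-1 : ℝ) ^ (2 * c + 1 - m) * h m) * φ (2 * x - ((2 * w + (2 * c + 1 - m) : ℤ) : ℝ)) := by
  rw [motherWavelet]
  congr 1
  refine Finset.sum_congr rfl fun m _ => ?_
  push_cast
  ring_nf

/-- Orthonormality of the translates of `φ`, read on the filter through the two-scale relation. -/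
theorem sum_filter (hφ : IsScalingFunction h φ) (v w : ℤ) :
    ∑ m ∈ h.support, ∑ m' ∈ h.support, h m * h m' * (if 2 * v + m = 2 * w + m' then 1 else 0) =
      if v = w then 1 else 0 := by
  rw [← hφ.orthonormal v w]
  have hexp : ∀ x, φ (x - v) * φ (x - w) = _ := fun x => by
    rw [hφ.twoScale_translate v, hφ.twoScale_translate w]
  simp_rw [hexp]
  exact (hφ.integral_combination _ _ _ (fun m => 2 * v + m) (fun m => 2 * w + m)).symm

theorem orthogonal_motherWavelet (hφ : IsScalingFunction h φ) (c v w : ℤ) :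
    ∫ x, φ (x - v) * motherWavelet h c φ (x - w) = 0 := by
  have hexp : ∀ x, φ (x - v) * motherWavelet h c φ (x - w) = _ := fun x => by
    rw [hφ.twoScale_translate v, motherWavelet_translate]
  simp_rw [hexp]
  rw [hφ.integral_combination _ _ _ (fun m => 2 * v + m) (fun m => 2 * w + (2 * c + 1 - m))]
  set S := ∑ m ∈ h.support, ∑ m' ∈ h.support, h m * ((-1 : ℝ) ^ (2 * c + 1 - m') * h m') *
    (if 2 * v + m = 2 * w + (2 * c + 1 - m') then (1 : ℝ) else 0) with hS
  -- The matching condition is symmetric in `m` and `m'` and forces `m + m'` to be odd, so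
  -- exchanging them reverses the sign.
  have hneg : S = -S := by
    conv_lhs => rw [hS, Finset.sum_comm]
    rw [hS, ← Finset.sum_neg_distrib]
    refine Finset.sum_congr rfl fun m _ => ?_
    rw [← Finset.sum_neg_distrib]
    refine Finset.sum_congr rfl fun m' _ => ?_
    by_cases hm : 2 * v + m = 2 * w + (2 * c + 1 - m')
    · have hm' : 2 * v + m' = 2 * w + (2 * c + 1 - m) := by linarith
      have hodd : Odd ((2 * c + 1 - m) + (2 * c + 1 - m')) :=
        ⟨c + v - w, by linarith⟩
      rw [if_pos hm, if_pos hm', neg_one_zpow_eq_neg_of_odd hodd]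
      ring
    · have hm' : ¬ 2 * v + m' = 2 * w + (2 * c + 1 - m) := fun h => hm (by linarith)
      rw [if_neg hm, if_neg hm']
      ring
  linarith

/-- After exchanging `m` and `m'` this is the filter identity `sum_filter`: matching indices have
the same parity, so the signs multiply to one. -/
theorem motherWavelet_orthonormal (hφ : IsScalingFunction h φ) (c v w : ℤ) :
    ∫ x, motherWavelet h c φ (x - v) * motherWavelet h c φ (x - w) = if v = w then 1 else 0 := by
  simp_rw [motherWavelet_translate]
  rw [hφ.integral_combination _ _ _ (fun m => 2 * v + (2 * c + 1 - m))
    (fun m => 2 * w + (2 * c + 1 - m)), ← hφ.sum_filter v w, Finset.sum_comm]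
  refine Finset.sum_congr rfl fun m _ => Finset.sum_congr rfl fun m' _ => ?_
  by_cases hm : 2 * v + m = 2 * w + m'
  · have hm' : 2 * v + (2 * c + 1 - m') = 2 * w + (2 * c + 1 - m) := by linarith
    have hpar : (-1 : ℝ) ^ (2 * c + 1 - m') = (-1 : ℝ) ^ (2 * c + 1 - m) := by
      rw [show 2 * c + 1 - m' = 2 * c + 1 - m + 2 * (w - v) by linarith,
        zpow_add₀ (by norm_num), (even_two_mul _).neg_one_zpow, mul_one]
    have hsq : (-1 : ℝ) ^ (2 * c + 1 - m) * (-1 : ℝ) ^ (2 * c + 1 - m) = 1 := by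
      rw [← mul_zpow]; norm_num
    rw [if_pos hm, if_pos hm', hpar]
    linear_combination (h m * h m') * hsq
  · have hm' : ¬ 2 * v + (2 * c + 1 - m') = 2 * w + (2 * c + 1 - m) := fun h => hm (by linarith)
    rw [if_neg hm, if_neg hm']
    ring

/-- The two-scale relation refines `φ` one level at a time until both factors live on the same
scale. -/
theorem orthogonal_motherWavelet_of_le (hφ : IsScalingFunction h φ) (c : ℤ) (n : ℕ) :
    ∀ (j : ℕ) (w w' : ℤ),
      ∫ x, φ (2 ^ j * x - w) * motherWavelet h c φ (2 ^ (j + n) * x - w') = 0 := by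
  induction n with
  | zero =>
    intro j w w'
    have := integral_comp_two_pow_mul_sub
      (fun y => φ (y - w) * motherWavelet h c φ (y - w')) j 0
    simpa [hφ.orthogonal_motherWavelet] using this
  | succ n ih =>
    intro j w w'
    have hψ : Continuous fun x : ℝ => motherWavelet h c φ (2 ^ (j + (n + 1)) * x - w') :=
      (continuous_generator hφ.continuous true).comp (by fun_prop)
    have hexp : ∀ x, φ (2 ^ j * x - w) * motherWavelet h c φ (2 ^ (j + (n + 1)) * x - w') =
        ∑ m ∈ h.support, √2 * h m * (φ (2 ^ (j + 1) * x - ((2 * w + m : ℤ) : ℝ)) *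
          motherWavelet h c φ (2 ^ (j + (n + 1)) * x - w')) := by
      intro x
      rw [hφ.twoScale_translate w, Finset.mul_sum, Finset.sum_mul]
      refine Finset.sum_congr rfl fun m _ => ?_
      rw [pow_succ 2 j, mul_comm ((2 : ℝ) ^ j) 2, mul_assoc 2 ((2 : ℝ) ^ j) x]
      ring
    simp_rw [hexp]
    rw [integral_finsetSum _ fun m _ => (hφ.integrable_comp_mul _ hψ _ _).const_mul _]
    refine Finset.sum_eq_zero fun m _ => ?_
    rw [integral_const_mul, show j + (n + 1) = j + 1 + n by ring, ih, mul_zero]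

theorem generator_orthogonal_of_lt (hφ : IsScalingFunction h φ) (c : ℤ) (e : Bool) {j j' : ℕ}
    (hj : j < j') (w w' : ℤ) :
    ∫ x, generator h c φ e (2 ^ j * x - w) * generator h c φ true (2 ^ j' * x - w') = 0 := by
  change ∫ x, generator h c φ e (2 ^ j * x - w) * motherWavelet h c φ (2 ^ j' * x - w') = 0
  have hψ : Continuous fun x : ℝ => motherWavelet h c φ (2 ^ j' * x - w') :=
    (continuous_generator hφ.continuous true).comp (by fun_prop)
  cases e
  · obtain ⟨n, rfl⟩ := Nat.exists_eq_add_of_le hj.le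
    exact hφ.orthogonal_motherWavelet_of_le c n j w w'
  · change ∫ x, motherWavelet h c φ (2 ^ j * x - w) * motherWavelet h c φ (2 ^ j' * x - w') = 0
    obtain ⟨n, rfl⟩ := Nat.exists_eq_add_of_le (Nat.succ_le_of_lt hj)
    have hexp : ∀ x, motherWavelet h c φ (2 ^ j * x - w) *
        motherWavelet h c φ (2 ^ (j.succ + n) * x - w') =
        ∑ m ∈ h.support, √2 * ((-1 : ℝ) ^ (2 * c + 1 - m) * h m) *
          (φ (2 ^ (j + 1) * x - ((2 * w + (2 * c + 1 - m) : ℤ) : ℝ)) *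
          motherWavelet h c φ (2 ^ (j.succ + n) * x - w')) := by
      intro x
      rw [motherWavelet_translate h c φ w, Finset.mul_sum, Finset.sum_mul]
      refine Finset.sum_congr rfl fun m _ => ?_
      rw [pow_succ 2 j, mul_comm ((2 : ℝ) ^ j) 2, mul_assoc 2 ((2 : ℝ) ^ j) x]
      ring
    simp_rw [hexp]
    rw [integral_finsetSum _ fun m _ => (hφ.integrable_comp_mul _ hψ _ _).const_mul _]
    refine Finset.sum_eq_zero fun m _ => ?_
    rw [integral_const_mul, hφ.orthogonal_motherWavelet_of_le c n (j + 1), mul_zero]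

theorem generator_orthonormal (hφ : IsScalingFunction h φ) (c : ℤ) (e e' : Bool) (j : ℕ)
    (w w' : ℤ) :
    ∫ x, generator h c φ e (2 ^ j * x - w) * generator h c φ e' (2 ^ j * x - w') =
      (2 ^ j : ℝ)⁻¹ * if e = e' ∧ w = w' then 1 else 0 := by
  have := integral_comp_two_pow_mul_sub
    (fun y => generator h c φ e (y - w) * generator h c φ e' (y - w')) j 0
  simp only [sub_zero] at this
  rw [this]
  congr 1
  cases e <;> cases e'
  · simpa [generator] using hφ.orthonormal w w'
  · simpa [generator] using hφ.orthogonal_motherWavelet c w w'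
  · simp only [generator, reduceIte, Bool.false_eq_true, mul_comm (motherWavelet h c φ _)]
    simpa using hφ.orthogonal_motherWavelet c w' w
  · simpa [generator] using hφ.motherWavelet_orthonormal c w w'

end IsScalingFunction

/-! ### Vanishing moments of the wavelet -/

theorem exists_radius_of_hasCompactSupport {θ : ℝ → ℝ} (h : HasCompactSupport θ) :
    ∃ T : ℝ, 0 < T ∧ ∀ x, T < |x| → θ x = 0 := by
  obtain ⟨T, hT⟩ := h.isCompact.isBounded.subset_closedBall 0
  refine ⟨max T 1, by positivity, fun x hx => ?_⟩
  by_contra hne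
  have := hT (subset_tsupport θ hne)
  rw [Metric.mem_closedBall, dist_zero_right, Real.norm_eq_abs] at this
  exact absurd ((le_max_left T 1).trans_lt hx) (not_lt.2 this)

/-- By the binomial formula, changing the base point alters a moment only by lower moments, which
vanish. -/
theorem VanishingMoments.moment_eq {l : ℕ} {ψ : ℝ → ℝ} (hψ : VanishingMoments l ψ)
    (hc : Continuous ψ) (hs : HasCompactSupport ψ) (y : ℝ) :
    ∫ s, (s - y) ^ l * ψ s = ∫ s, s ^ l * ψ s := by
  have hexp : ∀ s, (s - y) ^ l * ψ s = ∑ i ∈ Finset.range (l + 1),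
      (-y) ^ (l - i) * (l.choose i : ℝ) * ((s - 0) ^ i * ψ s) := by
    intro s
    rw [sub_eq_add_neg s y, add_pow, Finset.sum_mul]
    exact Finset.sum_congr rfl fun i _ => by rw [sub_zero]; ring
  have hint : ∀ i : ℕ, Integrable fun s => (s - 0) ^ i * ψ s := fun i =>
    Continuous.integrable_of_hasCompactSupport (by fun_prop) hs.mul_left
  simp_rw [hexp]
  rw [integral_finsetSum _ fun i _ => (hint i).const_mul _, Finset.sum_range_succ,
    Finset.sum_eq_zero fun i hi => ?_]
  · simp
  · rw [integral_const_mul, hψ 0 i (Finset.mem_range.1 hi), mul_zero]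

theorem VanishingMoments.moment_comp_sub {l : ℕ} {ψ : ℝ → ℝ} (hψ : VanishingMoments l ψ)
    (hc : Continuous ψ) (hs : HasCompactSupport ψ) (a t : ℝ) :
    ∫ s, (s - a) ^ l * ψ (s - t) = ∫ s, s ^ l * ψ s := by
  rw [← hψ.moment_eq hc hs (a - t),
    ← integral_sub_right_eq_self (fun s => (s - (a - t)) ^ l * ψ s) t]
  simp only [sub_sub, add_sub_cancel]

/-- The difference of two translates of a function has one more vanishing moment. -/
theorem VanishingMoments.sub_translate {l : ℕ} {ψ : ℝ → ℝ} (hψ : VanishingMoments l ψ)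
    (hc : Continuous ψ) (hs : HasCompactSupport ψ) (t u : ℝ) :
    VanishingMoments (l + 1) fun s => ψ (s - t) - ψ (s - u) := by
  intro a i hi
  have hint : ∀ v : ℝ, Integrable fun s => (s - a) ^ i * ψ (s - v) := fun v =>
    Continuous.integrable_of_hasCompactSupport (by fun_prop)
      (hs.comp_homeomorph (Homeomorph.subRight v)).mul_left
  have hψi : VanishingMoments i ψ := hψ.mono (Nat.lt_succ_iff.1 hi)
  simp_rw [mul_sub]
  rw [integral_sub (hint t) (hint u), hψi.moment_comp_sub hc hs, hψi.moment_comp_sub hc hs,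
    sub_self]

/-- Consider `G j t = ∫ φ(x) ψ(2 ^ j x - t)`. It vanishes at integers `t`. At a general `t`,
subtracting the value at `⌊t⌋` pairs `φ` with a function having one more vanishing moment, so `G j
t` has order `2 ^ (-j (l + 2))`. By Fubini and `∫ φ = 1`, integrating `G j t * t ^ l` recovers the
`l`-th moment of `ψ` up to sign. As `G j` is supported where `|t|` is of order at most `2 ^ j`, this
integral is `O(2 ^ (-j))`, so the moment is zero. -/
theorem VanishingMoments.succ_of_orthogonal {l : ℕ} {H T A : ℝ} {φ ψ : ℝ → ℝ}
    (hψ : VanishingMoments l ψ) (hφc : Continuous φ) (hψc : Continuous ψ) (hT : 0 < T)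
    (hA : 0 < A) (hφT : ∀ x, T < |x| → φ x = 0) (hψA : ∀ x, A < |x| → ψ x = 0)
    (hφ1 : ∫ x, φ x = 1) (hH : 0 ≤ H) (hdual : MomentDual (l + 1) (l + 1 : ℕ) H φ)
    (horth : ∀ (j : ℕ) (w : ℤ), ∫ x, φ x * ψ (2 ^ j * x - w) = 0) :
    VanishingMoments (l + 1) ψ := by
  have hψs : HasCompactSupport ψ := hasCompactSupport_of_radius (a := 0) (by simpa using hψA)
  have hφs : HasCompactSupport φ := hasCompactSupport_of_radius (a := 0) (by simpa using hφT)
  set μ := ∫ s, s ^ l * ψ s with hμ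
  set L := ∫ s, |ψ s| with hL
  have hL0 : 0 ≤ L := integral_nonneg fun _ => abs_nonneg _
  suffices hzero : μ = 0 by
    intro a i hi
    rcases Nat.lt_succ_iff_lt_or_eq.1 hi with hi | rfl
    · exact hψ a i hi
    · rw [hψ.moment_eq hψc hψs, ← hμ, hzero]
  let G : ℕ → ℝ → ℝ := fun j t => ∫ x, φ x * ψ (2 ^ j * x - t)
  have hGbound : ∀ j t, |G j t| ≤ H * ((A + 1) / 2 ^ j) ^ (l + 1) * ((2 ^ j)⁻¹ * (2 * L)) := by
    intro j t
    have h2 : (0 : ℝ) < 2 ^ j := by positivity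
    -- The translates lie within distance one of each other, so `χ` is supported in radius `A + 1`
    -- around `t`.
    set χ : ℝ → ℝ := fun s => ψ (s - t) - ψ (s - ⌊t⌋) with hχ
    have hint : ∀ v : ℝ, Integrable fun x => φ x * ψ (2 ^ j * x - v) := fun v =>
      Continuous.integrable_of_hasCompactSupport (by fun_prop) hφs.mul_right
    have hG : G j t = ∫ x, φ x * χ (2 ^ j * x - 0) := by
      simp only [hχ, sub_zero, mul_sub]
      rw [integral_sub (hint t) (hint ⌊t⌋), horth, sub_zero]
    have h3 := hdual (t / 2 ^ j) ((A + 1) / 2 ^ j) (fun x => χ (2 ^ j * x - 0)) (by positivity)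
      (by fun_prop) ?_ ((hψ.sub_translate hψc hψs t ⌊t⌋).comp_mul_sub h2.ne' 0)
    · rw [hG]
      rw [Real.rpow_natCast, integral_comp_two_pow_mul_sub (fun y => |χ y|)] at h3
      refine h3.trans ?_
      gcongr
      have hi : ∀ v : ℝ, Integrable fun s => |ψ (s - v)| := fun v =>
        ((hψc.integrable_of_hasCompactSupport hψs).comp_sub_right v).abs
      calc ∫ y, |χ y| ≤ ∫ y, (|ψ (y - t)| + |ψ (y - ⌊t⌋)|) :=
            integral_mono_of_nonneg (Eventually.of_forall fun _ => abs_nonneg _)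
              ((hi _).add (hi _)) (Eventually.of_forall fun y => abs_sub _ _)
        _ = 2 * L := by
          rw [integral_add (hi _) (hi _), integral_sub_right_eq_self (fun y => |ψ y|) t,
            integral_sub_right_eq_self (fun y => |ψ y|) (⌊t⌋ : ℝ)]
          ring
    · intro x hx
      have hx' : A + 1 < |2 ^ j * x - t| := by
        rw [div_lt_iff₀ h2] at hx
        calc A + 1 < |x - t / 2 ^ j| * 2 ^ j := hx
          _ = |(x - t / 2 ^ j) * 2 ^ j| := by rw [abs_mul, abs_of_pos h2]
          _ = _ := by congr 1; field_simp
      have h4 : |2 ^ j * x - t| ≤ |2 ^ j * x - ⌊t⌋| + |(⌊t⌋ : ℝ) - t| := abs_sub_le _ _ _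
      have h5 : |(⌊t⌋ : ℝ) - t| ≤ 1 := by
        rw [abs_sub_comm, abs_of_nonneg (by linarith [Int.floor_le t])]
        linarith [Int.lt_floor_add_one t]
      simp only [hχ, sub_zero]
      rw [hψA _ (by linarith), hψA _ (by linarith), sub_zero]
  have hGzero : ∀ j t, 2 ^ j * (T + A) < |t| → G j t = 0 := by
    intro j t ht
    refine (integral_congr_ae (Eventually.of_forall fun x => ?_)).trans (integral_zero _ _)
    rcases le_or_gt |x| T with hx | hx
    · have h6 : |t| ≤ |2 ^ j * x - t| + |2 ^ j * x| := by
        have := abs_sub_abs_le_abs_sub t (2 ^ j * x)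
        rw [abs_sub_comm] at this
        linarith
      have h7 : |2 ^ j * x| ≤ 2 ^ j * T := by
        rw [abs_mul, abs_of_pos (by positivity : (0 : ℝ) < 2 ^ j)]
        gcongr
      have h8 : A ≤ 2 ^ j * A := le_mul_of_one_le_left hA.le (one_le_pow₀ one_le_two)
      rw [hψA _ (by linarith), mul_zero]
    · simp [hφT x hx]
  have hmoment : ∀ j, ∫ t, G j t * t ^ l = (-1) ^ l * μ := by
    intro j
    have hF : Continuous (Function.uncurry fun (t x : ℝ) => φ x * ψ (2 ^ j * x - t) * t ^ l) := by
      fun_prop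
    have hFs : HasCompactSupport
        (Function.uncurry fun (t x : ℝ) => φ x * ψ (2 ^ j * x - t) * t ^ l) := by
      refine HasCompactSupport.intro
        ((isCompact_Icc (a := -(2 ^ j * T + A)) (b := 2 ^ j * T + A)).prod
          (isCompact_Icc (a := -T) (b := T))) ?_
      rintro ⟨t, x⟩ htx
      simp only [Function.uncurry]
      by_cases hx : |x| ≤ T
      · have ht : ¬ |t| ≤ 2 ^ j * T + A := fun ht =>
          htx (Set.mk_mem_prod (abs_le.1 ht) (abs_le.1 hx))
        have h6 : |t| ≤ |2 ^ j * x - t| + |2 ^ j * x| := by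
          have := abs_sub_abs_le_abs_sub t (2 ^ j * x)
          rw [abs_sub_comm] at this
          linarith
        have h7 : |2 ^ j * x| ≤ 2 ^ j * T := by
          rw [abs_mul, abs_of_pos (by positivity : (0 : ℝ) < 2 ^ j)]
          gcongr
        rw [hψA _ (by linarith), mul_zero, zero_mul]
      · rw [hφT x (not_le.1 hx), zero_mul, zero_mul]
    have hinner : ∀ x : ℝ, ∫ t, ψ (2 ^ j * x - t) * t ^ l = (-1) ^ l * μ := by
      intro x
      rw [hμ, ← hψ.moment_eq hψc hψs (2 ^ j * x), ← integral_const_mul,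
        ← integral_sub_left_eq_self _ volume (2 ^ j * x)]
      refine integral_congr_ae (Eventually.of_forall fun s => ?_)
      simp only [sub_sub_cancel]
      rw [← mul_assoc, ← mul_pow]
      ring
    calc ∫ t, G j t * t ^ l = ∫ t, ∫ x, φ x * ψ (2 ^ j * x - t) * t ^ l := by
          simp only [G, integral_mul_const]
      _ = ∫ x, ∫ t, φ x * ψ (2 ^ j * x - t) * t ^ l :=
          integral_integral_swap (hF.integrable_of_hasCompactSupport hFs)
      _ = _ := by
          simp_rw [mul_assoc, integral_const_mul, hinner, integral_mul_const, hφ1, one_mul]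
  set C := 2 * (T + A) ^ (l + 1) * (H * (A + 1) ^ (l + 1) * (2 * L)) with hC
  -- The bound is the interval length `2 * Q` times `B * Q ^ l`. The powers of `2 ^ j` in `Q ^ (l +
  -- 1)` cancel those in the duality bound, leaving the Jacobian `2 ^ (-j)`.
  have hbound : ∀ j : ℕ, |μ| ≤ C * (1 / 2) ^ j := by
    intro j
    set Q : ℝ := 2 ^ j * (T + A) with hQ
    have hQ0 : 0 ≤ Q := by positivity
    set B : ℝ := H * ((A + 1) / 2 ^ j) ^ (l + 1) * ((2 ^ j)⁻¹ * (2 * L)) with hB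
    have h1 : |μ| = ‖∫ t in Set.Icc (-Q) Q, G j t * t ^ l‖ := by
      rw [setIntegral_eq_integral_of_forall_compl_eq_zero, hmoment, Real.norm_eq_abs, abs_mul,
        abs_pow, abs_neg, abs_one, one_pow, one_mul]
      intro t ht
      rw [hGzero j t, zero_mul]
      by_contra hc
      exact ht (abs_le.1 (not_lt.1 hc))
    rw [h1]
    have h2 := norm_setIntegral_le_of_norm_le_const (μ := volume) (s := Set.Icc (-Q) Q)
      (f := fun t => G j t * t ^ l) (C := B * Q ^ l) (by simp) (fun t ht => by
        rw [Real.norm_eq_abs, abs_mul, abs_pow]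
        have := hGbound j t
        gcongr
        exact abs_le.2 ht)
    refine h2.trans (le_of_eq ?_)
    rw [Real.volume_real_Icc_of_le (by linarith)]
    have h2j : (2 : ℝ) ^ j ≠ 0 := by positivity
    rw [hB, hC, hQ, div_pow, mul_pow, one_div, inv_pow]
    field_simp
    ring
  have hlim : Tendsto (fun j : ℕ => C * (1 / 2 : ℝ) ^ j) atTop (𝓝 0) := by
    simpa using (tendsto_pow_atTop_nhds_zero_of_lt_one (by norm_num : (0 : ℝ) ≤ 1 / 2)
      (by norm_num)).const_mul C
  exact abs_nonpos_iff.1 (ge_of_tendsto' hlim hbound)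

theorem IsScalingFunction.vanishingMoments {h : ℤ →₀ ℝ} {φ : ℝ → ℝ} (hφ : IsScalingFunction h φ)
    (c : ℤ) {H : ℝ} (hH : 0 ≤ H) {N : ℕ} (hdual : ∀ l ≤ N, MomentDual l l H φ) :
    VanishingMoments N (motherWavelet h c φ) := by
  obtain ⟨T, hT, hφT⟩ := exists_radius_of_hasCompactSupport hφ.hasCompactSupport
  suffices ∀ l ≤ N, VanishingMoments l (motherWavelet h c φ) from this N le_rfl
  intro l
  induction l with
  | zero => intro _ a i hi; omega
  | succ l ih =>
    intro hl
    refine (ih (by omega)).succ_of_orthogonal hφ.continuous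
      (continuous_generator hφ.continuous true) hT (hT.trans_le (le_generatorRadius h c T)) hφT
      (fun x hx => generator_eq_zero hT.le hφT true hx) hφ.integral_eq_one hH (hdual _ hl)
      fun j w => ?_
    simpa using hφ.orthogonal_motherWavelet_of_le c j 0 0 w

/-! ### Integrals of tensor products and decay of the wavelet coefficients -/

theorem integral_RR_eq {k : ℕ} (F : RR k → ℝ) :
    ∫ x, F x = ∫ y : Fin k → ℝ, F (WithLp.toLp 2 y) :=
  ((PiLp.volume_preserving_toLp (Fin k)).integral_comp
    (MeasurableEquiv.toLp 2 (Fin k → ℝ)).measurableEmbedding F).symm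

theorem integral_tensor {k : ℕ} (g : Fin k → ℝ → ℝ) :
    ∫ x : RR k, ∏ l, g l (x l) = ∏ l, ∫ t, g l t := by
  rw [integral_RR_eq]
  exact integral_fintype_prod_volume_eq_prod g

theorem integrable_tensor {k : ℕ} {g : Fin k → ℝ → ℝ} (hg : ∀ l, Integrable (g l)) :
    Integrable fun x : RR k => ∏ l, g l (x l) := by
  have h1 : Integrable fun y : Fin k → ℝ => ∏ l, g l (y l) := Integrable.fintype_prod hg
  exact ((PiLp.volume_preserving_ofLp (Fin k)).integrable_comp_emb
    (MeasurableEquiv.toLp 2 (Fin k → ℝ)).symm.measurableEmbedding).2 h1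

/-- Fubini with coordinate `i` innermost: cancellation is used along that line only, and the other
coordinates enter through their `L¹` norms. -/
theorem abs_integral_mul_tensor_le {k : ℕ} (i : Fin k) {f : RR k → ℝ} {g : Fin k → ℝ → ℝ}
    {B M : ℝ} (hf : Continuous f) (hM : ∀ x, |f x| ≤ M) (hg : ∀ l, Integrable (g l))
    (hB : ∀ x, |∫ t, f (x + t • EuclideanSpace.single i (1 : ℝ)) * g i t| ≤ B * ∫ t, |g i t|) :
    |∫ x, f x * ∏ l, g l (x l)| ≤ B * ∏ l, ∫ t, |g l t| := by
  obtain ⟨k, rfl⟩ : ∃ k', k = k' + 1 := ⟨k - 1, by have := i.pos; omega⟩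
  have hint : Integrable fun x : RR (k + 1) => f x * ∏ l, g l (x l) :=
    (integrable_tensor hg).bdd_mul hf.aestronglyMeasurable (Eventually.of_forall hM)
  have hmp : MeasurePreserving (fun q : ℝ × (Fin k → ℝ) =>
      (WithLp.toLp 2 (i.insertNth q.1 q.2 : Fin (k + 1) → ℝ) : RR (k + 1))) :=
    (PiLp.volume_preserving_toLp (Fin (k + 1))).comp
      (volume_preserving_piFinSuccAbove (fun _ : Fin (k + 1) => ℝ) i).symm
  have hemb : MeasurableEmbedding (fun q : ℝ × (Fin k → ℝ) =>
      (WithLp.toLp 2 (i.insertNth q.1 q.2 : Fin (k + 1) → ℝ) : RR (k + 1))) :=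
    (MeasurableEquiv.toLp 2 (Fin (k + 1) → ℝ)).measurableEmbedding.comp
      (MeasurableEquiv.piFinSuccAbove (fun _ : Fin (k + 1) => ℝ) i).symm.measurableEmbedding
  have hint2 := (hmp.integrable_comp_emb hemb).2 hint
  rw [Function.comp_def] at hint2
  rw [← hmp.integral_comp hemb]
  rw [Measure.volume_eq_prod] at hint2 ⊢
  rw [integral_prod_symm _ hint2]
  have hline : ∀ (t : ℝ) (z : Fin k → ℝ),
      (WithLp.toLp 2 (i.insertNth t z : Fin (k + 1) → ℝ) : RR (k + 1)) =
      WithLp.toLp 2 (i.insertNth 0 z : Fin (k + 1) → ℝ) +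
        t • EuclideanSpace.single i (1 : ℝ) := by
    intro t z
    ext l
    refine Fin.succAboveCases i ?_ (fun l => ?_) l
    · simp
    · simp
  have hinner : ∀ z : Fin k → ℝ,
      |∫ t, f (WithLp.toLp 2 (i.insertNth t z : Fin (k + 1) → ℝ)) *
        ∏ l, g l ((WithLp.toLp 2 (i.insertNth t z : Fin (k + 1) → ℝ) : RR (k + 1)) l)| ≤
      (B * ∫ t, |g i t|) * ∏ l, |g (i.succAbove l) (z l)| := by
    intro z
    simp_rw [Fin.prod_univ_succAbove _ i]
    simp only [Fin.insertNth_apply_same, Fin.insertNth_apply_succAbove]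
    simp_rw [← mul_assoc]
    rw [integral_mul_const, abs_mul, Finset.abs_prod]
    refine mul_le_mul_of_nonneg_right ?_ (Finset.prod_nonneg fun _ _ => abs_nonneg _)
    simp_rw [fun t => congrArg f (hline t z)]
    exact hB _
  calc _ ≤ ∫ z : Fin k → ℝ, (B * ∫ t, |g i t|) * ∏ l, |g (i.succAbove l) (z l)| := by
        refine abs_integral_le_integral_abs.trans (integral_mono_of_nonneg
          (Eventually.of_forall fun _ => abs_nonneg _) ?_ (Eventually.of_forall hinner))
        exact (Integrable.fintype_prod (f := fun l t => |g (i.succAbove l) t|)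
          fun l => (hg _).abs).const_mul _
    _ = _ := by
        rw [integral_const_mul, Fin.prod_univ_succAbove _ i, mul_assoc,
          integral_fintype_prod_volume_eq_prod (fun l t => |g (i.succAbove l) t|)]

theorem tensorWavelet_eq {k : ℕ} (h : ℤ →₀ ℝ) (c : ℤ) (φ : ℝ → ℝ) {j : ℕ} {ε : Fin k → Bool}
    (hp : j = 0 ∨ ∃ i, ε i = true) (w : Fin k → ℤ) (x : RR k) :
    tensorWavelet h c φ j ε w x =
      (2 : ℝ) ^ ((j : ℝ) * k / 2) * ∏ l, generator h c φ (ε l) (2 ^ j * x l - w l) := by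
  rw [tensorWavelet, if_neg]
  · rfl
  · rintro ⟨hj, hε⟩
    rcases hp with hp | ⟨i, hi⟩
    · exact hj hp
    · simp [hε] at hi

theorem tensorWavelet_eq_zero {k : ℕ} (h : ℤ →₀ ℝ) (c : ℤ) (φ : ℝ → ℝ) {j : ℕ}
    {ε : Fin k → Bool} (hp : ¬ (j = 0 ∨ ∃ i, ε i = true)) (w : Fin k → ℤ) (x : RR k) :
    tensorWavelet h c φ j ε w x = 0 := by
  push Not at hp
  rw [tensorWavelet, if_pos]
  exact ⟨hp.1, funext fun i => by simpa using hp.2 i⟩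

theorem two_rpow_nat_mul (j : ℕ) (s : ℝ) : (2 : ℝ) ^ ((j : ℝ) * s) = ((2 : ℝ) ^ j) ^ s := by
  rw [Real.rpow_mul zero_le_two, Real.rpow_natCast]

theorem rpow_dilation (j k : ℕ) (η : ℝ) :
    (2 : ℝ) ^ ((j : ℝ) * k / 2) * ((2 ^ j : ℝ)⁻¹ ^ η * (2 ^ j : ℝ)⁻¹ ^ k) =
      (2 : ℝ) ^ (-((j : ℝ) * (η + k / 2))) := by
  rw [mul_div_assoc, ← mul_neg, two_rpow_nat_mul, two_rpow_nat_mul]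
  have h2 : (0 : ℝ) < 2 ^ j := by positivity
  rw [Real.inv_rpow h2.le, ← Real.rpow_neg h2.le, inv_pow, ← Real.rpow_natCast (2 ^ j) k,
    ← Real.rpow_neg h2.le, ← Real.rpow_add h2, ← Real.rpow_add h2]
  congr 1
  ring

section Coefficients

variable {h : ℤ →₀ ℝ} {φ : ℝ → ℝ}

theorem abs_generator_sub_eq_zero {c : ℤ} {θ : ℝ → ℝ} {T : ℝ} (hT : 0 ≤ T)
    (hθ : ∀ x, T < |x| → θ x = 0) (e : Bool) (j : ℕ) (w : ℤ) (x : ℝ)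
    (hx : generatorRadius h c T / 2 ^ j < |x - w / 2 ^ j|) :
    generator h c θ e (2 ^ j * x - w) = 0 := by
  have h2 : (0 : ℝ) < 2 ^ j := by positivity
  refine generator_eq_zero hT hθ e ?_
  rw [div_lt_iff₀ h2] at hx
  calc _ < |x - w / 2 ^ j| * 2 ^ j := hx
    _ = |(x - w / 2 ^ j) * 2 ^ j| := by rw [abs_mul, abs_of_pos h2]
    _ = _ := by congr 1; field_simp

theorem integrable_generator_comp {θ : ℝ → ℝ} {T : ℝ} (c : ℤ) (hc : Continuous θ) (hT : 0 ≤ T)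
    (hθ : ∀ x, T < |x| → θ x = 0) (e : Bool) (j : ℕ) (w : ℤ) :
    Integrable fun x => generator h c θ e (2 ^ j * x - w) := by
  have h1 := continuous_generator (h := h) (c := c) hc e
  exact Continuous.integrable_of_hasCompactSupport (by fun_prop)
    (hasCompactSupport_of_radius (abs_generator_sub_eq_zero hT hθ e j w))

/-- Decay of the wavelet coefficients of functions in a Hölder ball. -/
theorem exists_abs_waveletCoeff_le (hφ : IsScalingFunction h φ) (c : ℤ) {k : ℕ} (hk : 0 < k)
    {η : ℝ} (hη : 0 ≤ η) (hψ : VanishingMoments (⌊η⌋₊ + 1) (motherWavelet h c φ)) :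
    ∃ C : ℝ, 0 < C ∧ ∀ f : RR k → ℝ, InHolderBall η 1 f → ∀ j ε w,
      |waveletCoeff h c φ f j ε w| ≤ C * (2 : ℝ) ^ (-((j : ℝ) * (η + k / 2))) := by
  obtain ⟨T, hT, hφT⟩ := exists_radius_of_hasCompactSupport hφ.hasCompactSupport
  set A := generatorRadius h c T with hA
  have hA0 : 0 < A := hT.trans_le (le_generatorRadius h c T)
  set Λ : ℝ := (∫ t, |generator h c φ false t|) + ∫ t, |generator h c φ true t| with hΛ
  have hn : ∀ e, 0 ≤ ∫ t, |generator h c φ e t| := fun e => integral_nonneg fun _ => abs_nonneg _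
  have hΛe : ∀ e, ∫ t, |generator h c φ e t| ≤ Λ := by
    intro e
    cases e
    · exact le_add_of_nonneg_right (hn _)
    · exact le_add_of_nonneg_left (hn _)
  have hΛ0 : 0 ≤ Λ := add_nonneg (hn _) (hn _)
  refine ⟨(1 + A ^ η) * Λ ^ k + 1, by positivity, fun f hf j ε w => ?_⟩
  have h2 : (0 : ℝ) < 2 ^ j := by positivity
  have hpos : (0 : ℝ) < (2 : ℝ) ^ (-((j : ℝ) * (η + k / 2))) := by positivity
  by_cases hp : j = 0 ∨ ∃ i, ε i = true
  swap
  · simp only [waveletCoeff, tensorWavelet_eq_zero h c φ hp, mul_zero, integral_zero, abs_zero]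
    positivity
  -- A coordinate carrying the mother wavelet gives the decay by duality at radius `A / 2 ^ j`. If
  -- there is none, then `j = 0`, no decay is required, and the sup bound on `f` suffices for any
  -- coordinate.
  obtain ⟨i, hi⟩ : ∃ i : Fin k, ∀ x, |∫ t, f (x + t • EuclideanSpace.single i (1 : ℝ)) *
      generator h c φ (ε i) (2 ^ j * t - w i)| ≤
      (1 + A ^ η) * ((2 : ℝ) ^ j)⁻¹ ^ η * ∫ t, |generator h c φ (ε i) (2 ^ j * t - w i)| := by
    have hAη : 0 ≤ A ^ η := by positivity
    by_cases hε : ∃ i, ε i = true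
    · obtain ⟨i, hi⟩ := hε
      refine ⟨i, fun x => ?_⟩
      have h3 := hf.momentDual_line hη zero_le_one i x (w i / 2 ^ j) (A / 2 ^ j)
        (fun t => generator h c φ (ε i) (2 ^ j * t - w i)) (by positivity)
        ((continuous_generator hφ.continuous _).comp (by fun_prop))
        (abs_generator_sub_eq_zero hT.le hφT _ _ _)
        (by rw [hi]; exact hψ.comp_mul_sub h2.ne' _)
      refine h3.trans (mul_le_mul_of_nonneg_right ?_ (integral_nonneg fun _ => abs_nonneg _))
      rw [one_mul, div_eq_mul_inv, Real.mul_rpow hA0.le (by positivity)]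
      gcongr
      linarith
    · have hj : j = 0 := hp.resolve_right hε
      refine ⟨⟨0, hk⟩, fun x => ?_⟩
      subst hj
      simp only [pow_zero, inv_one, Real.one_rpow, mul_one]
      rw [← integral_const_mul]
      refine abs_integral_le_integral_abs.trans (integral_mono_of_nonneg
        (Eventually.of_forall fun _ => abs_nonneg _) ?_ (Eventually.of_forall fun t => ?_))
      · simpa using (integrable_generator_comp (h := h) c hφ.continuous hT.le hφT (ε ⟨0, hk⟩) 0
          (w ⟨0, hk⟩)).abs.const_mul (1 + A ^ η)
      · simp only [abs_mul]
        refine mul_le_mul_of_nonneg_right ?_ (abs_nonneg _)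
        exact (hf.abs_le zero_le_one _).trans (by linarith)
  have h4 := abs_integral_mul_tensor_le i hf.1 (hf.abs_le zero_le_one)
    (g := fun l t => generator h c φ (ε l) (2 ^ j * t - w l))
    (fun l => integrable_generator_comp c hφ.continuous hT.le hφT _ _ _) hi
  have h5 : ∏ l, ∫ t, |generator h c φ (ε l) (2 ^ j * t - w l)| ≤ ((2 ^ j : ℝ)⁻¹ * Λ) ^ k := by
    calc _ ≤ ∏ _l : Fin k, ((2 ^ j : ℝ)⁻¹ * Λ) := by
          refine Finset.prod_le_prod (fun l _ => integral_nonneg fun _ => abs_nonneg _)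
            fun l _ => ?_
          rw [integral_comp_two_pow_mul_sub (fun y => |generator h c φ (ε l) y|)]
          exact mul_le_mul_of_nonneg_left (hΛe _) (by positivity)
      _ = _ := by simp
  have h6 : waveletCoeff h c φ f j ε w = (2 : ℝ) ^ ((j : ℝ) * k / 2) *
      ∫ x, f x * ∏ l, generator h c φ (ε l) (2 ^ j * x l - w l) := by
    rw [waveletCoeff, ← integral_const_mul]
    refine integral_congr_ae (Eventually.of_forall fun x => ?_)
    simp only [tensorWavelet_eq h c φ hp]
    ring
  rw [h6, abs_mul, abs_of_pos (by positivity)]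
  calc _ ≤ (2 : ℝ) ^ ((j : ℝ) * k / 2) *
        ((1 + A ^ η) * ((2 : ℝ) ^ j)⁻¹ ^ η * ((2 ^ j : ℝ)⁻¹ * Λ) ^ k) := by
        gcongr
        exact h4.trans (by gcongr)
    _ = (1 + A ^ η) * Λ ^ k * ((2 : ℝ) ^ ((j : ℝ) * k / 2) *
        ((2 ^ j : ℝ)⁻¹ ^ η * (2 ^ j : ℝ)⁻¹ ^ k)) := by rw [mul_pow]; ring
    _ ≤ _ := by
        rw [rpow_dilation]
        gcongr
        linarith

end Coefficients

theorem holderInBesov_of_abs_waveletCoeff_le {k : ℕ} {h : ℤ →₀ ℝ} {c : ℤ} {φ : ℝ → ℝ} {η C : ℝ}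
    (H : ∀ f : RR k → ℝ, InHolderBall η 1 f → ∀ j ε w,
      |waveletCoeff h c φ f j ε w| ≤ C * (2 : ℝ) ^ (-((j : ℝ) * (η + k / 2)))) :
    HolderInBesov k h c φ η C := by
  intro f hf
  simp only [besovNorm, besovNormOn, lqNorm, if_true]
  refine iSup_le fun p => ?_
  calc _ ≤ ENNReal.ofReal ((2 : ℝ) ^ ((p.1 : ℝ) * (η + k / 2 - k * (⊤⁻¹ : ℝ≥0∞).toReal)) *
        (1 + p.1) ^ (0 : ℝ)) *
        ENNReal.ofReal (C * (2 : ℝ) ^ (-((p.1 : ℝ) * (η + k / 2)))) := by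
        gcongr
        exact iSup_le fun w => ENNReal.ofReal_le_ofReal (H f hf _ _ _)
    _ = ENNReal.ofReal C := by
        rw [← ENNReal.ofReal_mul (by positivity)]
        congr 1
        simp only [ENNReal.inv_top, ENNReal.toReal_zero, mul_zero, sub_zero, Real.rpow_zero,
          mul_one]
        rw [mul_left_comm, ← Real.rpow_add two_pos, add_neg_cancel, Real.rpow_zero, mul_one]

theorem HolderInBesov.abs_waveletCoeff_le {k : ℕ} {h : ℤ →₀ ℝ} {c : ℤ} {φ : ℝ → ℝ} {η C : ℝ}
    (hC : 0 ≤ C) (H : HolderInBesov k h c φ η C) {f : RR k → ℝ} (hf : InHolderBall η 1 f) (j : ℕ)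
    (ε : Fin k → Bool) (w : Fin k → ℤ) :
    |waveletCoeff h c φ f j ε w| ≤ C * (2 : ℝ) ^ (-((j : ℝ) * (η + k / 2))) := by
  have h1 := H f hf
  simp only [besovNorm, besovNormOn, lqNorm, if_true] at h1
  have h2 := (iSup_le_iff.1 h1) (j, ε)
  have h3 := (mul_le_mul_right (le_iSup (fun w : (Set.univ : Set (Fin k → ℤ)) =>
    ENNReal.ofReal |waveletCoeff h c φ f j ε w|) ⟨w, trivial⟩) _).trans h2
  rw [← ENNReal.ofReal_mul (by positivity), ENNReal.ofReal_le_ofReal_iff hC] at h3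
  simp only [ENNReal.inv_top, ENNReal.toReal_zero, mul_zero, sub_zero, Real.rpow_zero,
    mul_one] at h3
  rw [Real.rpow_neg zero_le_two, ← div_eq_mul_inv, le_div_iff₀ (by positivity), mul_comm]
  exact h3

/-- Admissibility bounds the coefficients already without the factor `K (1 + ‖w‖)`, which is at
least one. -/
theorem truncExpansion_mem_approxClass {k : ℕ} {h : ℤ →₀ ℝ} {c : ℤ} {φ : ℝ → ℝ} {η C K : ℝ}
    (hC : 0 ≤ C) (H : HolderInBesov k h c φ η C) (hK : 1 ≤ K) {f : RR k → ℝ}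
    (hf : InHolderBall η 1 f) (φ' : ℝ → ℝ) (δ : ℝ) (R : ℕ) :
    truncExpansion h c φ φ' δ R f ∈ approxClass k h c φ' η C K δ R := by
  refine ⟨waveletCoeff h c φ f, fun j _ ε w _ => (H.abs_waveletCoeff_le hC hf j ε w).trans ?_, rfl⟩
  gcongr
  rw [mul_assoc]
  refine le_mul_of_one_le_right hC ?_
  have := Real.sqrt_nonneg (∑ i, (w i : ℝ) ^ 2)
  nlinarith

/-! ### Almost orthogonality of wavelets built from different profiles -/

/-- Change variables and test `u` against the rescaled `ψ`, whose radius is `a * r`; the `N`-th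
power of `a` is all that remains. -/
theorem MomentDual.comp_mul_sub {N : ℕ} {H : ℝ} {u : ℝ → ℝ} (hu : MomentDual N N H u) {a : ℝ}
    (ha : 0 < a) (t : ℝ) : MomentDual N N (a ^ N * H) fun x => u (a * x - t) := by
  intro b r ψ hr hψ hsupp hmom
  have h1 := hu (a * b - t) (a * r) (fun y => ψ (a⁻¹ * y - -(a⁻¹ * t))) (by positivity)
    (by fun_prop) (fun y hy => hsupp _ ?_) (hmom.comp_mul_sub (inv_ne_zero ha.ne') _)
  · have h2 := integral_comp_mul_sub (fun y => u y * ψ (a⁻¹ * y - -(a⁻¹ * t))) a t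
    have h3 : ∀ x, a⁻¹ * (a * x - t) - -(a⁻¹ * t) = x := fun x => by field_simp; ring
    simp only [h3] at h2
    rw [integral_comp_mul_sub (fun y => |ψ y|), inv_inv, abs_of_pos ha] at h1
    rw [h2, abs_mul, abs_abs, abs_of_pos (inv_pos.2 ha)]
    calc _ ≤ a⁻¹ * (H * (a * r) ^ (N : ℝ) * (a * ∫ x, |ψ x|)) := by gcongr
      _ = _ := by
        rw [Real.mul_rpow ha.le hr.le, Real.rpow_natCast a]
        field_simp
  · have h4 : y - (a * b - t) = a * (a⁻¹ * y - -(a⁻¹ * t) - b) := by field_simp; ring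
    rw [h4, abs_mul, abs_of_pos ha] at hy
    exact lt_of_mul_lt_mul_left hy ha.le

/-- A continuous function supported in `[-T, T]`, of size `s` in the sup norm and in the sense of
duality with functions with `N` vanishing moments. -/
structure IsProfile (N : ℕ) (T s : ℝ) (θ : ℝ → ℝ) : Prop where
  continuous : Continuous θ
  abs_le : ∀ x, |θ x| ≤ s
  support : ∀ x, T < |x| → θ x = 0
  dual : MomentDual N N s θ

/-- The factor by which the size of a profile grows when the wavelet is built from it. -/
noncomputable def generatorGain (h : ℤ →₀ ℝ) (N : ℕ) : ℝ := 1 + √2 * ∑ m ∈ h.support, |h m| * 2 ^ N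

theorem one_le_generatorGain (h : ℤ →₀ ℝ) (N : ℕ) : 1 ≤ generatorGain h N :=
  le_add_of_nonneg_right (by positivity)

section Profile

variable {N : ℕ} {T s : ℝ} {θ : ℝ → ℝ}

theorem IsProfile.nonneg (hθ : IsProfile N T s θ) : 0 ≤ s := (abs_nonneg _).trans (hθ.abs_le 0)

/-- The wavelet is a finite combination of `θ(2x - m)`, and dilation by `2` costs `2 ^ N` in the
dual bound. No two-scale relation for `θ` is needed, so this applies to `φ - φ'`. -/
theorem IsProfile.generator (hθ : IsProfile N T s θ) (hT : 0 ≤ T) (h : ℤ →₀ ℝ) (c : ℤ)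
    (e : Bool) :
    IsProfile N (generatorRadius h c T) (generatorGain h N * s) (generator h c θ e) := by
  have hs := hθ.nonneg
  have hsign : ∀ m : ℤ, |(-1 : ℝ) ^ (2 * c + 1 - m) * h m| = |h m| := fun m => by
    rw [abs_mul, abs_zpow, abs_neg, abs_one, one_zpow, one_mul]
  refine ⟨continuous_generator hθ.continuous e, fun x => ?_,
    fun x hx => generator_eq_zero hT hθ.support e hx, ?_⟩
  · cases e
    · exact (hθ.abs_le x).trans (le_mul_of_one_le_left hs (one_le_generatorGain h N))
    · change |motherWavelet h c θ x| ≤ _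
      rw [motherWavelet, abs_mul, abs_of_nonneg (Real.sqrt_nonneg 2), generatorGain, add_mul,
        mul_assoc, Finset.sum_mul]
      refine le_add_of_nonneg_of_le (by linarith) ?_
      refine mul_le_mul_of_nonneg_left ?_ (Real.sqrt_nonneg 2)
      refine (Finset.abs_sum_le_sum_abs _ _).trans (Finset.sum_le_sum fun m _ => ?_)
      rw [abs_mul, hsign]
      refine mul_le_mul ?_ (hθ.abs_le _) (abs_nonneg _) (by positivity)
      exact le_mul_of_one_le_right (abs_nonneg _) (one_le_pow₀ one_le_two)
  · intro a r ψ hr hψ hsupp hmom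
    have hB : 0 ≤ s * r ^ (N : ℝ) * ∫ x, |ψ x| :=
      mul_nonneg (by positivity) (integral_nonneg fun _ => abs_nonneg _)
    cases e
    · refine (hθ.dual a r ψ hr hψ hsupp hmom).trans ?_
      have := le_mul_of_one_le_left hB (one_le_generatorGain h N)
      calc _ ≤ _ := this
        _ = _ := by ring
    · change |∫ x, motherWavelet h c θ x * ψ x| ≤ _
      have hcs := hasCompactSupport_of_radius hsupp
      have hθc := hθ.continuous
      have hexp : ∀ x, motherWavelet h c θ x * ψ x = ∑ m ∈ h.support,
          √2 * ((-1 : ℝ) ^ (2 * c + 1 - m) * h m) *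
            (θ (2 * x - ((2 * c + 1 - m : ℤ) : ℝ)) * ψ x) := by
        intro x
        rw [motherWavelet, Finset.mul_sum, Finset.sum_mul]
        exact Finset.sum_congr rfl fun m _ => by ring
      have hint : ∀ m : ℤ, Integrable fun x => √2 * ((-1 : ℝ) ^ (2 * c + 1 - m) * h m) *
          (θ (2 * x - ((2 * c + 1 - m : ℤ) : ℝ)) * ψ x) := fun m =>
        (Continuous.integrable_of_hasCompactSupport (by fun_prop) hcs.mul_left).const_mul _
      simp_rw [hexp]
      rw [integral_finsetSum _ fun m _ => hint m]
      calc _ ≤ ∑ m ∈ h.support, √2 * (|h m| * 2 ^ N) * (s * r ^ (N : ℝ) * ∫ x, |ψ x|) := by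
            refine (Finset.abs_sum_le_sum_abs _ _).trans (Finset.sum_le_sum fun m _ => ?_)
            rw [integral_const_mul, abs_mul, abs_mul, abs_of_nonneg (Real.sqrt_nonneg 2), hsign]
            have h5 := hθ.dual.comp_mul_sub two_pos ((2 * c + 1 - m : ℤ) : ℝ) a r ψ hr hψ hsupp
              hmom
            calc _ ≤ √2 * |h m| * (2 ^ N * s * r ^ (N : ℝ) * ∫ x, |ψ x|) := by gcongr
              _ = _ := by ring
        _ = (√2 * ∑ m ∈ h.support, |h m| * 2 ^ N) * (s * r ^ (N : ℝ) * ∫ x, |ψ x|) := by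
            rw [Finset.mul_sum, Finset.sum_mul]
        _ ≤ generatorGain h N * (s * r ^ (N : ℝ) * ∫ x, |ψ x|) := by
            refine mul_le_mul_of_nonneg_right ?_ hB
            rw [generatorGain]
            linarith
        _ = _ := by ring

theorem card_le_of_abs_sub_le {S : Finset ℤ} {y T : ℝ} (hT : 0 ≤ T)
    (hS : ∀ w ∈ S, |y - w| ≤ T) : (S.card : ℝ) ≤ 2 * T + 1 := by
  have hsub : S ⊆ Finset.Icc ⌈y - T⌉ ⌊y + T⌋ := by
    intro w hw
    have := abs_le.1 (hS w hw)
    rw [Finset.mem_Icc, Int.ceil_le, Int.le_floor]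
    exact ⟨by linarith, by linarith⟩
  have h1 := Finset.card_le_card hsub
  rw [Int.card_Icc] at h1
  have h2 : (S.card : ℝ) ≤ ((⌊y + T⌋ + 1 - ⌈y - T⌉).toNat : ℝ) := by exact_mod_cast h1
  refine h2.trans ?_
  rcases le_total 0 (⌊y + T⌋ + 1 - ⌈y - T⌉) with h3 | h3
  · have h4 : ((⌊y + T⌋ + 1 - ⌈y - T⌉).toNat : ℝ) = ((⌊y + T⌋ + 1 - ⌈y - T⌉ : ℤ) : ℝ) := by
      exact_mod_cast Int.toNat_of_nonneg h3
    rw [h4]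
    push_cast
    linarith [Int.floor_le (y + T), Int.le_ceil (y - T)]
  · rw [Int.toNat_of_nonpos h3]
    push_cast
    linarith

theorem sum_le_card_mul_of_abs_sub_le {S : Finset ℤ} {y T B : ℝ} {F : ℤ → ℝ} (hT : 0 ≤ T)
    (hB : 0 ≤ B) (hF : ∀ w, F w ≤ B) (hF0 : ∀ w : ℤ, T < |y - w| → F w = 0) :
    ∑ w ∈ S, F w ≤ (2 * T + 1) * B := by
  rw [← Finset.sum_filter_of_ne (p := fun w : ℤ => |y - w| ≤ T)
    fun w _ hw => not_lt.1 fun h => hw (hF0 w h)]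
  refine (Finset.sum_le_card_nsmul _ _ B fun w _ => hF w).trans ?_
  rw [nsmul_eq_mul]
  exact mul_le_mul_of_nonneg_right
    (card_le_of_abs_sub_le hT fun w hw => (Finset.mem_filter.1 hw).2) hB

/-- The pairing of two dilated and translated functions. -/
noncomputable def dyadicPairing (θ χ : ℝ → ℝ) (j : ℕ) (w : ℤ) (j' : ℕ) (w' : ℤ) : ℝ :=
  ∫ x, θ (2 ^ j * x - w) * χ (2 ^ j' * x - w')

variable {A : ℝ} {χ : ℝ → ℝ}

theorem radius_scaled (hχA : ∀ x, A < |x| → χ x = 0) (j : ℕ) (w : ℤ) (x : ℝ)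
    (hx : A / 2 ^ j < |x - w / 2 ^ j|) : χ (2 ^ j * x - w) = 0 := by
  have h2 : (0 : ℝ) < 2 ^ j := by positivity
  refine hχA _ ?_
  rw [div_lt_iff₀ h2] at hx
  calc _ < |x - w / 2 ^ j| * 2 ^ j := hx
    _ = |(x - w / 2 ^ j) * 2 ^ j| := by rw [abs_mul, abs_of_pos h2]
    _ = _ := by congr 1; field_simp

theorem IsProfile.integrable_pairing (hθ : IsProfile N T s θ) (hχ : Continuous χ)
    (hχA : ∀ x, A < |x| → χ x = 0) (j : ℕ) (w : ℤ) (j' : ℕ) (w' : ℤ) :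
    Integrable fun x => θ (2 ^ j * x - w) * χ (2 ^ j' * x - w') := by
  have := hθ.continuous
  exact Continuous.integrable_of_hasCompactSupport (by fun_prop)
    (hasCompactSupport_of_radius (radius_scaled hχA j' w')).mul_left

/-- At each point at most `2T + 1` of the translates of `θ` are nonzero, so summing over `w` costs
only a constant. Without moments there is no decay. -/
theorem IsProfile.sum_abs_pairing_le (hθ : IsProfile N T s θ) (hT : 0 ≤ T) (hχ : Continuous χ)
    (hχA : ∀ x, A < |x| → χ x = 0) (S : Finset ℤ) (j j' : ℕ) (w' : ℤ) :
    ∑ w ∈ S, |dyadicPairing θ χ j w j' w'| ≤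
      (2 * T + 1) * s * ((2 ^ j' : ℝ)⁻¹ * ∫ x, |χ x|) := by
  have hi := fun w => (hθ.integrable_pairing hχ hχA j w j' w').abs
  have hχi : Integrable fun x : ℝ => |χ (2 ^ j' * x - w')| :=
    (Continuous.integrable_of_hasCompactSupport (by fun_prop)
      (hasCompactSupport_of_radius (radius_scaled hχA j' w'))).abs
  calc ∑ w ∈ S, |dyadicPairing θ χ j w j' w'|
      ≤ ∑ w ∈ S, ∫ x, |θ (2 ^ j * x - w) * χ (2 ^ j' * x - w')| :=
        Finset.sum_le_sum fun w _ => abs_integral_le_integral_abs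
    _ = ∫ x, ∑ w ∈ S, |θ (2 ^ j * x - w) * χ (2 ^ j' * x - w')| :=
        (integral_finsetSum _ fun w _ => hi w).symm
    _ ≤ ∫ x, (2 * T + 1) * s * |χ (2 ^ j' * x - w')| := by
        refine integral_mono (integrable_finsetSum _ fun w _ => hi w) (hχi.const_mul _)
          fun x => ?_
        simp only [abs_mul]
        rw [← Finset.sum_mul]
        refine mul_le_mul_of_nonneg_right ?_ (abs_nonneg _)
        refine sum_le_card_mul_of_abs_sub_le (y := 2 ^ j * x) hT hθ.nonneg (fun w => hθ.abs_le _)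
          fun w hw => ?_
        rw [hθ.support _ hw, abs_zero]
    _ = _ := by
        rw [integral_const_mul, integral_comp_two_pow_mul_sub (fun y => |χ y|)]

/-- When `χ` is finer, its support meets boundedly many translates of `θ`, and each pairing gains
`(2 ^ j / 2 ^ j') ^ N` by duality. -/
theorem IsProfile.sum_abs_pairing_le_of_le (hθ : IsProfile N T s θ) (hT : 0 ≤ T) (hA : 0 < A)
    (hχ : Continuous χ) (hχA : ∀ x, A < |x| → χ x = 0) (hmom : VanishingMoments N χ)
    (S : Finset ℤ) {j j' : ℕ} (hj : j ≤ j') (w' : ℤ) :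
    ∑ w ∈ S, |dyadicPairing θ χ j w j' w'| ≤
      (2 * (T + A) + 1) * (s * A ^ N * (2 ^ j / 2 ^ j' : ℝ) ^ N *
        ((2 ^ j' : ℝ)⁻¹ * ∫ x, |χ x|)) := by
  have h2 : (0 : ℝ) < 2 ^ j := by positivity
  have h2' : (0 : ℝ) < 2 ^ j' := by positivity
  have hs := hθ.nonneg
  have hL : 0 ≤ ∫ x, |χ x| := integral_nonneg fun _ => abs_nonneg _
  refine sum_le_card_mul_of_abs_sub_le (y := 2 ^ j * (w' / 2 ^ j')) (by linarith)
    (by positivity) (fun w => ?_) fun w hw => ?_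
  · have h1 := hθ.dual.comp_mul_sub h2 w (w' / 2 ^ j') (A / 2 ^ j')
      (fun x => χ (2 ^ j' * x - w')) (by positivity) (by fun_prop)
      (radius_scaled hχA j' w') (hmom.comp_mul_sub h2'.ne' _)
    rw [Real.rpow_natCast, integral_comp_two_pow_mul_sub (fun y => |χ y|)] at h1
    refine h1.trans (le_of_eq ?_)
    rw [div_pow, div_pow]
    ring
  · rw [abs_eq_zero]
    refine (integral_congr_ae (Eventually.of_forall fun x => ?_)).trans (integral_zero _ _)
    rcases le_or_gt |x - w' / 2 ^ j'| (A / 2 ^ j') with hx | hx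
    · have h3 : |(2 ^ j * (w' / 2 ^ j') - w : ℝ)| ≤ |2 ^ j * x - w| + 2 ^ j * |x - w' / 2 ^ j'| := by
        have : (2 ^ j * (w' / 2 ^ j') - w : ℝ) =
            (2 ^ j * x - w) - 2 ^ j * (x - w' / 2 ^ j') := by ring
        rw [this]
        refine (abs_sub _ _).trans ?_
        rw [abs_mul (2 ^ j : ℝ), abs_of_pos h2]
      have h4 : 2 ^ j * |x - w' / 2 ^ j'| ≤ A := by
        calc _ ≤ (2 : ℝ) ^ j' * (A / 2 ^ j') := by
              gcongr
              exact one_le_two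
          _ = A := by field_simp
      rw [hθ.support _ (by linarith), zero_mul]
    · rw [radius_scaled hχA j' w' x hx, mul_zero]

end Profile

/-- The gain from vanishing moments when pairing a wavelet with one of finer scale. -/
noncomputable def levelDecay (N j j' : ℕ) : ℝ := if j ≤ j' then (2 ^ j / 2 ^ j' : ℝ) ^ N else 1

theorem levelDecay_pos (N j j' : ℕ) : 0 < levelDecay N j j' := by
  unfold levelDecay
  split_ifs <;> positivity

theorem levelDecay_le_one (N j j' : ℕ) : levelDecay N j j' ≤ 1 := by
  unfold levelDecay
  split_ifs with h
  · refine pow_le_one₀ (by positivity) ?_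
    rw [div_le_one (by positivity)]
    exact pow_le_pow_right₀ one_le_two h
  · exact le_rfl

/-- One constant for all profiles, linear in their size `s`. Only the moments of the exact wavelet
are used, hence no gain for `j > j'`; there the decay of the coefficients will take over. -/
theorem IsScalingFunction.exists_sum_abs_pairing_le {h : ℤ →₀ ℝ} {φ : ℝ → ℝ}
    (hφ : IsScalingFunction h φ) (c : ℤ) {N : ℕ}
    (hψ : VanishingMoments N (motherWavelet h c φ)) {T : ℝ} (hT : 0 < T)
    (hφT : ∀ x, T < |x| → φ x = 0) :
    ∃ C : ℝ, 0 < C ∧ ∀ (s : ℝ) (θ : ℝ → ℝ), IsProfile N T s θ →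
      ∀ (S : Finset ℤ) (j j' : ℕ) (w' : ℤ) (e e' : Bool),
        ∑ w ∈ S, |dyadicPairing (generator h c θ e) (generator h c φ e') j w j' w'| ≤
          C * s * ((2 ^ j' : ℝ)⁻¹ * if e' = true then levelDecay N j j' else 1) := by
  set A := generatorRadius h c T with hA
  have hA0 : 0 < A := hT.trans_le (le_generatorRadius h c T)
  set Λ : ℝ := (∫ t, |generator h c φ false t|) + ∫ t, |generator h c φ true t| with hΛ
  have hn : ∀ e, 0 ≤ ∫ t, |generator h c φ e t| := fun e => integral_nonneg fun _ => abs_nonneg _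
  have hΛe : ∀ e, ∫ t, |generator h c φ e t| ≤ Λ := by
    intro e
    cases e
    · exact le_add_of_nonneg_right (hn _)
    · exact le_add_of_nonneg_left (hn _)
  have hΛ0 : 0 ≤ Λ := add_nonneg (hn _) (hn _)
  have hG := one_le_generatorGain h N
  have hG0 : 0 < generatorGain h N := by linarith
  refine ⟨(2 * (A + A) + 1) * generatorGain h N * (1 + A ^ N) * (Λ + 1), by positivity,
    fun s θ hθ S j j' w' e e' => ?_⟩
  have hp := hθ.generator hT.le h c e
  have hs := hθ.nonneg
  have hχ := continuous_generator (h := h) (c := c) hφ.continuous e'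
  have hχA : ∀ x, A < |x| → generator h c φ e' x = 0 :=
    fun x hx => generator_eq_zero hT.le hφT e' hx
  have hL : ∫ t, |generator h c φ e' t| ≤ Λ + 1 := (hΛe e').trans (by linarith)
  have hbasic := hp.sum_abs_pairing_le hA0.le hχ hχA S j j' w'
  have hone : ∑ w ∈ S, |dyadicPairing (generator h c θ e) (generator h c φ e') j w j' w'| ≤
      (2 * (A + A) + 1) * generatorGain h N * (1 + A ^ N) * (Λ + 1) * s *
        ((2 ^ j' : ℝ)⁻¹ * 1) := by
    refine hbasic.trans ?_
    calc _ ≤ (2 * A + 1) * (generatorGain h N * s) * ((2 ^ j' : ℝ)⁻¹ * (Λ + 1)) := by gcongr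
      _ = (2 * A + 1) * 1 * (generatorGain h N * s * (2 ^ j' : ℝ)⁻¹ * (Λ + 1)) := by ring
      _ ≤ (2 * (A + A) + 1) * (1 + A ^ N) * (generatorGain h N * s * (2 ^ j' : ℝ)⁻¹ * (Λ + 1)) := by
        gcongr
        · linarith
        · exact le_add_of_nonneg_right (by positivity)
      _ = _ := by ring
  cases e'
  · simpa using hone
  · by_cases hj : j ≤ j'
    · simp only [levelDecay, if_pos hj, if_true]
      refine (hp.sum_abs_pairing_le_of_le hA0.le hA0 hχ hχA hψ S hj w').trans ?_
      calc _ ≤ (2 * (A + A) + 1) * (generatorGain h N * s * (1 + A ^ N) *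
            (2 ^ j / 2 ^ j' : ℝ) ^ N * ((2 ^ j' : ℝ)⁻¹ * (Λ + 1))) := by
            gcongr
            linarith
        _ = _ := by ring
    · simpa only [levelDecay, if_neg hj, if_true] using hone

/-! ### Perturbation of tensor products -/

/-- The right side is the sum of all mixed products with at least one difference factor, written so
that sums over a product grid still factorise. -/
theorem abs_prod_sub_prod_le {ι : Type*} (s : Finset ι) (a b : ι → ℝ) :
    |∏ i ∈ s, a i - ∏ i ∈ s, b i| ≤ ∏ i ∈ s, (|b i| + |a i - b i|) - ∏ i ∈ s, |b i| := by
  classical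
  induction s using Finset.induction_on with
  | empty => simp
  | insert i s hi ih =>
    simp only [Finset.prod_insert hi]
    set P := ∏ i ∈ s, a i
    set Q := ∏ i ∈ s, b i with hQ
    have h1 : |a i| ≤ |b i| + |a i - b i| := by
      have := abs_add_le (b i) (a i - b i)
      rwa [add_sub_cancel] at this
    have h2 : |Q| = ∏ i ∈ s, |b i| := Finset.abs_prod _ _
    calc |a i * P - b i * Q| = |a i * (P - Q) + (a i - b i) * Q| := by ring_nf
      _ ≤ |a i| * |P - Q| + |a i - b i| * |Q| := by
        rw [← abs_mul, ← abs_mul]; exact abs_add_le _ _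
      _ ≤ (|b i| + |a i - b i|) * (∏ i ∈ s, (|b i| + |a i - b i|) - ∏ i ∈ s, |b i|) +
          |a i - b i| * |Q| := by gcongr
      _ = _ := by rw [h2]; ring

/-- Each of the `2 ^ s.card - 1` mixed products has at least one factor `τ`; the remaining powers
are discarded using `τ ≤ 1`. -/
theorem prod_add_sub_prod_le {ι : Type*} (s : Finset ι) {B D M : ι → ℝ} {τ : ℝ} (hτ : 0 ≤ τ)
    (hτ1 : τ ≤ 1) (hB : ∀ i, 0 ≤ B i) (hD : ∀ i, 0 ≤ D i) (hBM : ∀ i, B i ≤ M i)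
    (hDM : ∀ i, D i ≤ τ * M i) :
    ∏ i ∈ s, (B i + D i) - ∏ i ∈ s, B i ≤ τ * ((2 ^ s.card - 1) * ∏ i ∈ s, M i) := by
  classical
  have hM : ∀ i, 0 ≤ M i := fun i => (hB i).trans (hBM i)
  induction s using Finset.induction_on with
  | empty => simp
  | insert i s hi ih =>
    simp only [Finset.prod_insert hi, Finset.card_insert_of_notMem hi]
    have h1 : ∏ i ∈ s, B i ≤ ∏ i ∈ s, M i := Finset.prod_le_prod (fun i _ => hB i) fun i _ => hBM i
    have h2 : 0 ≤ ∏ i ∈ s, B i := Finset.prod_nonneg fun i _ => hB i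
    have h3 : ∏ i ∈ s, B i ≤ ∏ i ∈ s, (B i + D i) :=
      Finset.prod_le_prod (fun i _ => hB i) fun i _ => le_add_of_nonneg_right (hD i)
    have h4 : B i + D i ≤ 2 * M i := by
      have := mul_le_mul_of_nonneg_right hτ1 (hM i)
      linarith [hBM i, hDM i]
    calc _ = (B i + D i) * (∏ i ∈ s, (B i + D i) - ∏ i ∈ s, B i) + D i * ∏ i ∈ s, B i := by ring
      _ ≤ (2 * M i) * (τ * ((2 ^ s.card - 1) * ∏ i ∈ s, M i)) + (τ * M i) * ∏ i ∈ s, M i := by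
        refine add_le_add (mul_le_mul h4 ih (sub_nonneg.2 h3) (by linarith [hM i])) ?_
        exact mul_le_mul (hDM i) h1 h2 (mul_nonneg hτ (hM i))
      _ = _ := by rw [pow_succ]; ring

theorem sum_abs_prod_sub_prod_le {k : ℕ} (S : Finset ℤ) {a b : Fin k → ℤ → ℝ} {M : Fin k → ℝ}
    {τ : ℝ} (hτ : 0 ≤ τ) (hτ1 : τ ≤ 1) (hb : ∀ i, ∑ w ∈ S, |b i w| ≤ M i)
    (hab : ∀ i, ∑ w ∈ S, |a i w - b i w| ≤ τ * M i) :
    ∑ w ∈ Fintype.piFinset fun _ : Fin k => S, |∏ i, a i (w i) - ∏ i, b i (w i)| ≤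
      τ * (2 ^ k * ∏ i, M i) := by
  have hM : ∀ i, 0 ≤ M i := fun i => (Finset.sum_nonneg fun _ _ => abs_nonneg _).trans (hb i)
  calc _ ≤ ∑ w ∈ Fintype.piFinset fun _ : Fin k => S,
        (∏ i, (|b i (w i)| + |a i (w i) - b i (w i)|) - ∏ i, |b i (w i)|) :=
        Finset.sum_le_sum fun w _ => abs_prod_sub_prod_le _ _ _
    _ = ∏ i, (∑ w ∈ S, |b i w| + ∑ w ∈ S, |a i w - b i w|) - ∏ i, ∑ w ∈ S, |b i w| := by
        simp_rw [← Finset.sum_add_distrib]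
        rw [Finset.sum_sub_distrib,
          Finset.prod_univ_sum (fun _ => S) fun i w => |b i w| + |a i w - b i w|,
          Finset.prod_univ_sum (fun _ => S) fun i w => |b i w|]
    _ ≤ τ * ((2 ^ (Finset.univ : Finset (Fin k)).card - 1) * ∏ i, M i) :=
        prod_add_sub_prod_le _ hτ hτ1 (fun i => Finset.sum_nonneg fun _ _ => abs_nonneg _)
          (fun i => Finset.sum_nonneg fun _ _ => abs_nonneg _) hb hab
    _ ≤ _ := by
        rw [Finset.card_univ, Fintype.card_fin]
        gcongr
        · exact Finset.prod_nonneg fun i _ => hM i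
        · linarith

/-! ### Summation over levels -/

theorem sum_range_pow_dist_le {q : ℝ} (hq : 0 ≤ q) (hq1 : q < 1) (n j' : ℕ) :
    ∑ j ∈ Finset.range n, (if j ≤ j' then q ^ (j' - j) else q ^ (j - j')) ≤ 2 * (1 - q)⁻¹ := by
  have hgeom : ∀ s : Finset ℕ, ∑ j ∈ s, q ^ j ≤ (1 - q)⁻¹ := fun s => by
    rw [← tsum_geometric_of_lt_one hq hq1]
    exact (summable_geometric_of_lt_one hq hq1).sum_le_tsum _ fun i _ => pow_nonneg hq i
  rw [Finset.sum_ite]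
  have h1 : ∑ j ∈ (Finset.range n).filter (fun j => j ≤ j'), q ^ (j' - j) ≤ (1 - q)⁻¹ := by
    rw [← Finset.sum_image (f := fun i => q ^ i) (g := fun j => j' - j)]
    · exact hgeom _
    · intro x hx y hy hxy
      have hx' := (Finset.mem_filter.1 hx).2
      have hy' := (Finset.mem_filter.1 hy).2
      simp only at hxy
      omega
  have h2 : ∑ j ∈ (Finset.range n).filter (fun j => ¬ j ≤ j'), q ^ (j - j') ≤ (1 - q)⁻¹ := by
    rw [← Finset.sum_image (f := fun i => q ^ i) (g := fun j => j - j')]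
    · exact hgeom _
    · intro x hx y hy hxy
      have hx' := (Finset.mem_filter.1 hx).2
      have hy' := (Finset.mem_filter.1 hy).2
      simp only at hxy
      omega
  linarith

/-- For coarser `j` the gain `2 ^ (-(j' - j) N)` beats the loss `2 ^ ((j' - j) η)`; for finer `j`
the factor `2 ^ (-j η)` is itself summable. -/
theorem exists_sum_levelDecay_le {η : ℝ} {N : ℕ} (hη : 0 < η) (hN : η < N) :
    ∃ C : ℝ, 0 < C ∧ ∀ n j' : ℕ,
      ∑ j ∈ Finset.range n, (2 : ℝ) ^ (-((j : ℝ) * η)) * levelDecay N j j' ≤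
        C * (2 : ℝ) ^ (-((j' : ℝ) * η)) := by
  -- The common rate of geometric decay on both sides of `j'`.
  set μ := min η (N - η) with hμ
  have hμ0 : 0 < μ := lt_min hη (sub_pos.2 hN)
  set q : ℝ := (2 : ℝ) ^ (-μ) with hq
  have hq0 : 0 < q := by positivity
  have hq1 : q < 1 := Real.rpow_lt_one_of_one_lt_of_neg one_lt_two (neg_neg_of_pos hμ0)
  have hqi : ∀ (i : ℕ) (s : ℝ), μ ≤ s → (2 : ℝ) ^ (-((i : ℝ) * s)) ≤ q ^ i := by
    intro i s hs
    rw [hq, ← Real.rpow_natCast, ← Real.rpow_mul zero_le_two]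
    refine Real.rpow_le_rpow_of_exponent_le one_le_two ?_
    nlinarith [(Nat.cast_nonneg i : (0 : ℝ) ≤ i)]
  refine ⟨2 * (1 - q)⁻¹, mul_pos two_pos (inv_pos.2 (sub_pos.2 hq1)), fun n j' => ?_⟩
  refine le_trans ?_ (mul_le_mul_of_nonneg_right (sum_range_pow_dist_le hq0.le hq1 n j')
    (by positivity))
  rw [Finset.sum_mul]
  refine Finset.sum_le_sum fun j _ => ?_
  by_cases hj : j ≤ j'
  · obtain ⟨i, rfl⟩ := Nat.exists_eq_add_of_le hj
    rw [levelDecay, if_pos hj, if_pos hj, Nat.add_sub_cancel_left]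
    have h1 : ((2 : ℝ) ^ j / 2 ^ (j + i)) ^ N = (2 : ℝ) ^ (-((i : ℝ) * N)) := by
      rw [pow_add, div_mul_cancel_left₀ (by positivity), inv_pow, ← pow_mul,
        Real.rpow_neg zero_le_two, ← Nat.cast_mul, Real.rpow_natCast]
    have h2 : (2 : ℝ) ^ (-((j : ℝ) * η)) * (2 : ℝ) ^ (-((i : ℝ) * N)) =
        (2 : ℝ) ^ (-((i : ℝ) * (N - η))) * (2 : ℝ) ^ (-(((j + i : ℕ) : ℝ) * η)) := by
      rw [← Real.rpow_add two_pos, ← Real.rpow_add two_pos]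
      congr 1
      push_cast
      ring
    rw [h1, h2]
    exact mul_le_mul_of_nonneg_right (hqi _ _ (min_le_right _ _)) (by positivity)
  · obtain ⟨i, rfl⟩ := Nat.exists_eq_add_of_le (not_le.1 hj).le
    rw [levelDecay, if_neg hj, if_neg hj, Nat.add_sub_cancel_left, mul_one]
    have h2 : (2 : ℝ) ^ (-(((j' + i : ℕ) : ℝ) * η)) =
        (2 : ℝ) ^ (-((i : ℝ) * η)) * (2 : ℝ) ^ (-((j' : ℝ) * η)) := by
      rw [← Real.rpow_add two_pos]
      congr 1
      push_cast
      ring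
    rw [h2]
    exact mul_le_mul_of_nonneg_right (hqi _ _ (min_le_left _ _)) (by positivity)

/-! ### Pairings of tensor wavelets -/

section Tensor

variable {k : ℕ} {h : ℤ →₀ ℝ} {c : ℤ} {φ θ : ℝ → ℝ}

theorem integral_tensorWavelet_mul {j j' : ℕ} {ε ε' : Fin k → Bool}
    (hp : j = 0 ∨ ∃ i, ε i = true) (hp' : j' = 0 ∨ ∃ i, ε' i = true) (w w' : Fin k → ℤ) :
    ∫ x, tensorWavelet h c θ j ε w x * tensorWavelet h c φ j' ε' w' x =
      (2 : ℝ) ^ ((j : ℝ) * k / 2) * (2 : ℝ) ^ ((j' : ℝ) * k / 2) *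
        ∏ i, dyadicPairing (generator h c θ (ε i)) (generator h c φ (ε' i)) j (w i) j' (w' i) := by
  unfold dyadicPairing
  rw [← integral_tensor (fun i t =>
    generator h c θ (ε i) (2 ^ j * t - w i) * generator h c φ (ε' i) (2 ^ j' * t - w' i)),
    ← integral_const_mul]
  refine integral_congr_ae (Eventually.of_forall fun x => ?_)
  simp only [tensorWavelet_eq h c _ hp, tensorWavelet_eq h c _ hp', Finset.prod_mul_distrib]
  ring

theorem IsScalingFunction.tensorWavelet_orthonormal (hφ : IsScalingFunction h φ) {j' : ℕ}
    {ε' : Fin k → Bool} (hp' : j' = 0 ∨ ∃ i, ε' i = true) (j : ℕ) (ε : Fin k → Bool)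
    (w w' : Fin k → ℤ) :
    ∫ x, tensorWavelet h c φ j ε w x * tensorWavelet h c φ j' ε' w' x =
      if j = j' ∧ ε = ε' ∧ w = w' then 1 else 0 := by
  by_cases hp : j = 0 ∨ ∃ i, ε i = true
  swap
  · rw [if_neg]
    · simp [tensorWavelet_eq_zero h c φ hp]
    · rintro ⟨rfl, rfl, -⟩
      exact hp hp'
  rw [integral_tensorWavelet_mul hp hp']
  unfold dyadicPairing
  rcases lt_trichotomy j j' with hj | rfl | hj
  -- The finer level is positive, so its wavelet has a mother-wavelet coordinate, and that
  -- one-dimensional factor vanishes.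
  · obtain ⟨i, hi⟩ := hp'.resolve_left (by omega)
    rw [if_neg fun h => hj.ne h.1, Finset.prod_eq_zero (Finset.mem_univ i), mul_zero]
    rw [hi]
    exact hφ.generator_orthogonal_of_lt c _ hj _ _
  · simp_rw [hφ.generator_orthonormal]
    by_cases hall : ε = ε' ∧ w = w'
    · obtain ⟨rfl, rfl⟩ := hall
      simp only [and_self, if_true, mul_one, Finset.prod_const, Finset.card_univ,
        Fintype.card_fin]
      rw [← Real.rpow_add two_pos, add_halves, ← Nat.cast_mul, Real.rpow_natCast, pow_mul,
        ← mul_pow, mul_inv_cancel₀ (by positivity), one_pow]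
    · rw [if_neg fun h => hall h.2]
      obtain ⟨i, hi⟩ : ∃ i, ¬ (ε i = ε' i ∧ w i = w' i) := by
        by_contra hcon
        push Not at hcon
        exact hall ⟨funext fun i => (hcon i).1, funext fun i => (hcon i).2⟩
      rw [Finset.prod_eq_zero (Finset.mem_univ i), mul_zero]
      rw [if_neg hi, mul_zero]
  · obtain ⟨i, hi⟩ := hp.resolve_left (by omega)
    rw [if_neg fun h => hj.ne' h.1, Finset.prod_eq_zero (Finset.mem_univ i), mul_zero]
    rw [hi]
    simp_rw [mul_comm (generator h c φ true _)]
    exact hφ.generator_orthogonal_of_lt c _ hj _ _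

/-- The index `(j', ε', w')` must occur in the sum; this is why the error is measured only at grid
locations. -/
theorem sum_mul_indicator {a : ℕ → (Fin k → Bool) → (Fin k → ℤ) → ℝ} {n R j' : ℕ}
    {ε' : Fin k → Bool} {w' : Fin k → ℤ} (hw' : w' ∈ waveletGrid k R j') :
    ∑ j ∈ Finset.range n, ∑ ε : Fin k → Bool, ∑ w ∈ waveletGrid k R j,
      a j ε w * (if j = j' ∧ ε = ε' ∧ w = w' then (1 : ℝ) else 0) =
      if j' < n then a j' ε' w' else 0 := by
  have hin : ∀ j, ∑ ε : Fin k → Bool, ∑ w ∈ waveletGrid k R j,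
      a j ε w * (if j = j' ∧ ε = ε' ∧ w = w' then (1 : ℝ) else 0) =
      if j = j' then a j' ε' w' else 0 := by
    intro j
    by_cases hj : j = j'
    · subst hj
      rw [if_pos rfl, Finset.sum_eq_single ε', Finset.sum_eq_single w']
      · simp
      · intro w _ hw; simp [hw]
      · exact fun h => absurd hw' h
      · intro ε _ hε; simp [hε]
      · simp
    · simp [hj]
  simp_rw [hin]
  rw [Finset.sum_ite_eq']
  simp

end Tensor

/-! ### Wavelet coefficients of the truncation error -/

section TruncationError

variable {k : ℕ} {h : ℤ →₀ ℝ} {c : ℤ} {φ θ : ℝ → ℝ} {T : ℝ}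

theorem integrable_tensorWavelet (hT : 0 ≤ T) (hθ : Continuous θ) (hθT : ∀ x, T < |x| → θ x = 0)
    (j : ℕ) (ε : Fin k → Bool) (w : Fin k → ℤ) : Integrable (tensorWavelet h c θ j ε w) := by
  by_cases hp : j = 0 ∨ ∃ i, ε i = true
  · refine (Integrable.const_mul (integrable_tensor fun l => integrable_generator_comp (h := h) c
      hθ hT hθT (ε l) j (w l)) ((2 : ℝ) ^ ((j : ℝ) * k / 2))).congr
      (Eventually.of_forall fun x => ?_)
    exact (tensorWavelet_eq h c θ hp w x).symm
  · refine (integrable_zero _ _ _).congr (Eventually.of_forall fun x => ?_)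
    exact (tensorWavelet_eq_zero h c θ hp w x).symm

theorem integrable_tensorWavelet_mul (hT : 0 ≤ T) (hθ : Continuous θ) (hφ : Continuous φ)
    (hφT : ∀ x, T < |x| → φ x = 0) (j j' : ℕ) (ε ε' : Fin k → Bool) (w w' : Fin k → ℤ) :
    Integrable fun x => tensorWavelet h c θ j ε w x * tensorWavelet h c φ j' ε' w' x := by
  by_cases hp : j = 0 ∨ ∃ i, ε i = true
  swap
  · simp only [tensorWavelet_eq_zero h c θ hp, zero_mul]
    exact integrable_zero _ _ _
  by_cases hp' : j' = 0 ∨ ∃ i, ε' i = true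
  swap
  · simp only [tensorWavelet_eq_zero h c φ hp', mul_zero]
    exact integrable_zero _ _ _
  have h1 : ∀ l, Integrable fun t : ℝ => generator h c θ (ε l) (2 ^ j * t - w l) *
      generator h c φ (ε' l) (2 ^ j' * t - w' l) := fun l => by
    have h2 := continuous_generator (h := h) (c := c) hθ (ε l)
    have h3 := continuous_generator (h := h) (c := c) hφ (ε' l)
    exact Continuous.integrable_of_hasCompactSupport (by fun_prop)
      (hasCompactSupport_of_radius (abs_generator_sub_eq_zero hT hφT (ε' l) j' (w' l))).mul_left
  refine ((integrable_tensor h1).const_mul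
    ((2 : ℝ) ^ ((j : ℝ) * k / 2) * (2 : ℝ) ^ ((j' : ℝ) * k / 2))).congr
    (Eventually.of_forall fun x => ?_)
  simp only [tensorWavelet_eq h c _ hp, tensorWavelet_eq h c _ hp', Finset.prod_mul_distrib]
  ring

theorem dyadicPairing_generator_sub (hT : 0 ≤ T) (hφ : Continuous φ) (hθ : Continuous θ)
    (hφT : ∀ x, T < |x| → φ x = 0) (e e' : Bool) (j : ℕ) (w : ℤ) (j' : ℕ) (w' : ℤ) :
    dyadicPairing (generator h c θ e) (generator h c φ e') j w j' w' -
      dyadicPairing (generator h c φ e) (generator h c φ e') j w j' w' =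
    -dyadicPairing (generator h c (fun x => φ x - θ x) e) (generator h c φ e') j w j' w' := by
  have hint : ∀ θ : ℝ → ℝ, Continuous θ → Integrable fun t : ℝ =>
      generator h c θ e (2 ^ j * t - w) * generator h c φ e' (2 ^ j' * t - w') := fun θ hθ => by
    have h2 := continuous_generator (h := h) (c := c) hθ e
    have h3 := continuous_generator (h := h) (c := c) hφ e'
    exact Continuous.integrable_of_hasCompactSupport (by fun_prop)
      (hasCompactSupport_of_radius (abs_generator_sub_eq_zero hT hφT e' j' w')).mul_left
  simp only [dyadicPairing, generator_sub, sub_mul]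
  rw [integral_sub (hint φ hφ) (hint θ hθ), neg_sub]

/-- One coordinate with `ε' i = true` already provides the decay. At `j' = 0` nothing is claimed,
because `levelDecay N j 0 = 1`. -/
theorem prod_ite_levelDecay_le {N j j' : ℕ} {ε' : Fin k → Bool}
    (hp' : j' = 0 ∨ ∃ i, ε' i = true) :
    ∏ i, (if ε' i = true then levelDecay N j j' else 1) ≤ levelDecay N j j' := by
  have h0 := (levelDecay_pos N j j').le
  have h1 := levelDecay_le_one N j j'
  have h2 : ∀ i, 0 ≤ if ε' i = true then levelDecay N j j' else 1 := fun i => by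
    split_ifs
    exacts [h0, zero_le_one]
  have h3 : ∀ i, (if ε' i = true then levelDecay N j j' else 1) ≤ 1 := fun i => by
    split_ifs
    exacts [h1, le_rfl]
  rcases hp' with rfl | ⟨i, hi⟩
  · have : levelDecay N j 0 = 1 := by
      unfold levelDecay
      split_ifs with hj
      · obtain rfl : j = 0 := by omega
        simp
      · rfl
    rw [this]
    simp
  · rw [← Finset.mul_prod_erase _ _ (Finset.mem_univ i), if_pos hi]
    exact mul_le_of_le_one_right h0 (Finset.prod_le_one (fun i _ => h2 i) fun i _ => h3 i)

theorem waveletCoeff_sub_truncExpansion (hT : 0 ≤ T) (hφ : Continuous φ) (hθ : Continuous θ)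
    (hφT : ∀ x, T < |x| → φ x = 0) {f : RR k → ℝ} {M : ℝ} (hf : Continuous f)
    (hfM : ∀ x, |f x| ≤ M) (δ : ℝ) (R : ℕ) (j' : ℕ) (ε' : Fin k → Bool) (w' : Fin k → ℤ) :
    waveletCoeff h c φ (fun x => f x - truncExpansion h c φ θ δ R f x) j' ε' w' =
      waveletCoeff h c φ f j' ε' w' -
      ∑ j ∈ Finset.range (maxLevel δ + 1), ∑ ε : Fin k → Bool, ∑ w ∈ waveletGrid k R j,
        waveletCoeff h c φ f j ε w *
          ∫ x, tensorWavelet h c θ j ε w x * tensorWavelet h c φ j' ε' w' x := by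
  have hm := fun j ε w => integrable_tensorWavelet_mul (h := h) (c := c) hT hθ hφ hφT j j' ε ε' w w'
  have h1 : Integrable fun x => f x * tensorWavelet h c φ j' ε' w' x :=
    (integrable_tensorWavelet hT hφ hφT j' ε' w').bdd_mul hf.aestronglyMeasurable
      (Eventually.of_forall hfM)
  have h2 : ∀ x, truncExpansion h c φ θ δ R f x * tensorWavelet h c φ j' ε' w' x =
      ∑ j ∈ Finset.range (maxLevel δ + 1), ∑ ε : Fin k → Bool, ∑ w ∈ waveletGrid k R j,
        waveletCoeff h c φ f j ε w *
          (tensorWavelet h c θ j ε w x * tensorWavelet h c φ j' ε' w' x) := by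
    intro x
    simp only [truncExpansion, waveletSum, Finset.sum_mul, mul_assoc]
  have h3 : ∀ j, ∀ ε : Fin k → Bool, Integrable fun x => ∑ w ∈ waveletGrid k R j,
      waveletCoeff h c φ f j ε w *
        (tensorWavelet h c θ j ε w x * tensorWavelet h c φ j' ε' w' x) := fun j ε =>
    integrable_finsetSum _ fun w _ => (hm j ε w).const_mul _
  have h4 : ∀ j, Integrable fun x => ∑ ε : Fin k → Bool, ∑ w ∈ waveletGrid k R j,
      waveletCoeff h c φ f j ε w *
        (tensorWavelet h c θ j ε w x * tensorWavelet h c φ j' ε' w' x) := fun j =>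
    integrable_finsetSum _ fun ε _ => h3 j ε
  rw [waveletCoeff]
  simp_rw [sub_mul, h2]
  rw [integral_sub h1 (integrable_finsetSum _ fun j _ => h4 j),
    integral_finsetSum _ fun j _ => h4 j]
  congr 1
  refine Finset.sum_congr rfl fun j _ => ?_
  rw [integral_finsetSum _ fun ε _ => h3 j ε]
  refine Finset.sum_congr rfl fun ε _ => ?_
  rw [integral_finsetSum _ fun w _ => (hm j ε w).const_mul _]
  exact Finset.sum_congr rfl fun w _ => integral_const_mul _ _

/-- At each level, the wavelets of an approximate profile are almost biorthogonal to the exact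
ones. -/
theorem IsScalingFunction.exists_sum_abs_tensor_sub_le (hφ : IsScalingFunction h φ) (c : ℤ)
    (k : ℕ) {N : ℕ} (hψ : VanishingMoments N (motherWavelet h c φ)) {A : ℝ} (hT : 0 < T)
    (hφp : IsProfile N T A φ) :
    ∃ C : ℝ, 0 < C ∧ ∀ (τ : ℝ) (φ' : ℝ → ℝ), τ ≤ 1 → Continuous φ' →
      IsProfile N T τ (fun x => φ x - φ' x) →
      ∀ (R j j' : ℕ) (ε ε' : Fin k → Bool) (w' : Fin k → ℤ), (j' = 0 ∨ ∃ i, ε' i = true) →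
        ∑ w ∈ waveletGrid k R j,
          |(∫ x, tensorWavelet h c φ' j ε w x * tensorWavelet h c φ j' ε' w' x) -
            ∫ x, tensorWavelet h c φ j ε w x * tensorWavelet h c φ j' ε' w' x| ≤
          C * τ * ((2 : ℝ) ^ ((j : ℝ) * k / 2) * (2 : ℝ) ^ (-((j' : ℝ) * k / 2)) *
            levelDecay N j j') := by
  obtain ⟨C, hC, hsum⟩ := hφ.exists_sum_abs_pairing_le c hψ hT hφp.support
  have hA := hφp.nonneg
  refine ⟨2 ^ k * (C * (A + 1)) ^ k, by positivity,
    fun τ φ' hτ1 hφ' hp R j j' ε ε' w' hv' => ?_⟩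
  have hτ := hp.nonneg
  have hd0 := levelDecay_pos N j j'
  by_cases hv : j = 0 ∨ ∃ i, ε i = true
  swap
  · simp only [tensorWavelet_eq_zero h c _ hv, zero_mul, integral_zero, sub_self, abs_zero,
      Finset.sum_const_zero]
    positivity
  simp only [integral_tensorWavelet_mul hv hv', ← mul_sub, abs_mul]
  rw [← Finset.mul_sum, abs_of_pos (by positivity), abs_of_pos (by positivity)]
  -- A bound for the exact pairings which, multiplied by `τ`, also bounds the perturbations; `A + 1`
  -- dominates both sizes `A` and `1`.
  set M : Fin k → ℝ := fun i =>
    C * (A + 1) * ((2 ^ j' : ℝ)⁻¹ * if ε' i = true then levelDecay N j j' else 1) with hM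
  have hM0 : ∀ i, (0 : ℝ) ≤ (2 ^ j' : ℝ)⁻¹ * if ε' i = true then levelDecay N j j' else 1 :=
    fun i => by split_ifs <;> positivity
  have h1 := sum_abs_prod_sub_prod_le (k := k) (Finset.Icc (-((R : ℤ) * 2 ^ j)) ((R : ℤ) * 2 ^ j))
    (a := fun i w => dyadicPairing (generator h c φ' (ε i)) (generator h c φ (ε' i)) j w j' (w' i))
    (b := fun i w => dyadicPairing (generator h c φ (ε i)) (generator h c φ (ε' i)) j w j' (w' i))
    (M := M) hτ hτ1
    (fun i => (hsum A φ hφp _ j j' (w' i) (ε i) (ε' i)).trans (by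
      simp only [hM]
      have := hM0 i
      gcongr
      linarith))
    (fun i => by
      simp only [dyadicPairing_generator_sub hT.le hφ.continuous hφ' hφp.support, abs_neg]
      refine (hsum τ _ hp _ j j' (w' i) (ε i) (ε' i)).trans ?_
      simp only [hM]
      have := hM0 i
      calc _ = 1 * (C * τ * ((2 ^ j' : ℝ)⁻¹ * if ε' i = true then levelDecay N j j' else 1)) := by
            ring
        _ ≤ (A + 1) * (C * τ * ((2 ^ j' : ℝ)⁻¹ * if ε' i = true then levelDecay N j j' else 1)) := by
            gcongr
            linarith
        _ = _ := by ring)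
  have h2 : ∏ i, M i ≤ (C * (A + 1)) ^ k * ((2 ^ j' : ℝ)⁻¹ ^ k * levelDecay N j j') := by
    simp only [hM, Finset.prod_mul_distrib, Finset.prod_const, Finset.card_univ, Fintype.card_fin,
      mul_pow]
    gcongr
    exact prod_ite_levelDecay_le hv'
  have h3 : (2 : ℝ) ^ ((j' : ℝ) * k / 2) * (2 ^ j' : ℝ)⁻¹ ^ k = (2 : ℝ) ^ (-((j' : ℝ) * k / 2)) := by
    have := rpow_dilation j' k 0
    rw [Real.rpow_zero, one_mul, zero_add] at this
    rw [this, mul_div_assoc]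
  calc _ ≤ (2 : ℝ) ^ ((j : ℝ) * k / 2) * (2 : ℝ) ^ ((j' : ℝ) * k / 2) * (τ * (2 ^ k *
        ((C * (A + 1)) ^ k * ((2 ^ j' : ℝ)⁻¹ ^ k * levelDecay N j j')))) := by
        refine mul_le_mul_of_nonneg_left (h1.trans ?_) (by positivity)
        gcongr
    _ = 2 ^ k * (C * (A + 1)) ^ k * τ * ((2 : ℝ) ^ ((j : ℝ) * k / 2) *
        ((2 : ℝ) ^ ((j' : ℝ) * k / 2) * (2 ^ j' : ℝ)⁻¹ ^ k) * levelDecay N j j') := by ring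
    _ = _ := by rw [h3]

/-- The wavelet coefficients of `f` minus its truncated expansion. -/
theorem IsScalingFunction.exists_abs_waveletCoeff_error_le (hφ : IsScalingFunction h φ) (c : ℤ)
    {N : ℕ} (hψ : VanishingMoments N (motherWavelet h c φ)) {A : ℝ} (hT : 0 < T)
    (hφp : IsProfile N T A φ) {η : ℝ} (hη : 0 < η) (hN : η < N) {C₀ : ℝ} (hC₀ : 0 < C₀)
    (hcoeff : ∀ f : RR k → ℝ, InHolderBall η 1 f → ∀ j ε w,
      |waveletCoeff h c φ f j ε w| ≤ C₀ * (2 : ℝ) ^ (-((j : ℝ) * (η + k / 2)))) :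
    ∃ C : ℝ, 0 < C ∧ ∀ (τ : ℝ) (φ' : ℝ → ℝ), τ ≤ 1 → Continuous φ' →
      IsProfile N T τ (fun x => φ x - φ' x) →
      ∀ (R : ℕ) (δ : ℝ) (f : RR k → ℝ), InHolderBall η 1 f →
      ∀ (j' : ℕ) (ε' : Fin k → Bool), ∀ w' ∈ waveletGrid k R j',
        |waveletCoeff h c φ (fun x => f x - truncExpansion h c φ φ' δ R f x) j' ε' w'| ≤
          C * (τ + if maxLevel δ < j' then 1 else 0) * (2 : ℝ) ^ (-((j' : ℝ) * (η + k / 2))) := by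
  obtain ⟨C₁, hC₁, hten⟩ := hφ.exists_sum_abs_tensor_sub_le c k hψ hT hφp
  obtain ⟨C₂, hC₂, hlev⟩ := exists_sum_levelDecay_le hη hN
  refine ⟨C₀ + 2 ^ k * C₀ * C₁ * C₂, by positivity,
    fun τ φ' hτ1 hφ' hp R δ f hf j' ε' w' hw' => ?_⟩
  have hτ := hp.nonneg
  set Y : ℝ := (2 : ℝ) ^ (-((j' : ℝ) * (η + k / 2))) with hY
  have hY0 : 0 < Y := by positivity
  by_cases hv' : j' = 0 ∨ ∃ i, ε' i = true
  swap
  · simp only [waveletCoeff, tensorWavelet_eq_zero h c _ hv', mul_zero, integral_zero, abs_zero]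
    split_ifs <;> positivity
  set a := waveletCoeff h c φ f with ha
  set P : ℕ → (Fin k → Bool) → (Fin k → ℤ) → ℝ := fun j ε w =>
    ∫ x, tensorWavelet h c φ j ε w x * tensorWavelet h c φ j' ε' w' x with hP
  set P' : ℕ → (Fin k → Bool) → (Fin k → ℤ) → ℝ := fun j ε w =>
    ∫ x, tensorWavelet h c φ' j ε w x * tensorWavelet h c φ j' ε' w' x with hP'
  rw [waveletCoeff_sub_truncExpansion hT.le hφ.continuous hφ' hφp.support hf.1
    (hf.abs_le zero_le_one)]
  -- With exact wavelets in place of approximate ones the truncated expansion reproduces the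
  -- coefficient, up to the last level.
  have hmain : ∑ j ∈ Finset.range (maxLevel δ + 1), ∑ ε : Fin k → Bool,
      ∑ w ∈ waveletGrid k R j, a j ε w * P j ε w =
      if j' < maxLevel δ + 1 then a j' ε' w' else 0 := by
    simp only [hP, hφ.tensorWavelet_orthonormal hv']
    exact sum_mul_indicator hw'
  have hsplit : a j' ε' w' - ∑ j ∈ Finset.range (maxLevel δ + 1), ∑ ε : Fin k → Bool,
      ∑ w ∈ waveletGrid k R j, a j ε w * P' j ε w =
      (a j' ε' w' - if j' < maxLevel δ + 1 then a j' ε' w' else 0) -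
      ∑ j ∈ Finset.range (maxLevel δ + 1), ∑ ε : Fin k → Bool,
        ∑ w ∈ waveletGrid k R j, a j ε w * (P' j ε w - P j ε w) := by
    rw [← hmain]
    simp only [mul_sub, Finset.sum_sub_distrib]
    ring
  have hfirst : |a j' ε' w' - if j' < maxLevel δ + 1 then a j' ε' w' else 0| ≤
      C₀ * (if maxLevel δ < j' then 1 else 0) * Y := by
    by_cases hj : maxLevel δ < j'
    · rw [if_neg (by omega), if_pos hj, sub_zero, mul_one]
      exact hcoeff f hf _ _ _
    · rw [if_pos (by omega), if_neg hj]
      simp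
  have hsecond : |∑ j ∈ Finset.range (maxLevel δ + 1), ∑ ε : Fin k → Bool,
      ∑ w ∈ waveletGrid k R j, a j ε w * (P' j ε w - P j ε w)| ≤
      2 ^ k * C₀ * C₁ * C₂ * τ * Y := by
    calc _ ≤ ∑ j ∈ Finset.range (maxLevel δ + 1), ∑ ε : Fin k → Bool,
          ∑ w ∈ waveletGrid k R j, |a j ε w| * |P' j ε w - P j ε w| := by
          refine (Finset.abs_sum_le_sum_abs _ _).trans (Finset.sum_le_sum fun j _ => ?_)
          refine (Finset.abs_sum_le_sum_abs _ _).trans (Finset.sum_le_sum fun ε _ => ?_)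
          refine (Finset.abs_sum_le_sum_abs _ _).trans (Finset.sum_le_sum fun w _ => ?_)
          rw [abs_mul]
      _ ≤ ∑ j ∈ Finset.range (maxLevel δ + 1), ∑ _ε : Fin k → Bool,
          C₀ * (2 : ℝ) ^ (-((j : ℝ) * (η + k / 2))) *
          (C₁ * τ * ((2 : ℝ) ^ ((j : ℝ) * k / 2) * (2 : ℝ) ^ (-((j' : ℝ) * k / 2)) *
            levelDecay N j j')) := by
          refine Finset.sum_le_sum fun j _ => Finset.sum_le_sum fun ε _ => ?_
          refine le_trans ?_ (mul_le_mul_of_nonneg_left (hten τ φ' hτ1 hφ' hp R j j' ε ε' w' hv')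
            (by positivity))
          rw [Finset.mul_sum]
          exact Finset.sum_le_sum fun w _ =>
            mul_le_mul_of_nonneg_right (hcoeff f hf _ _ _) (abs_nonneg _)
      _ = 2 ^ k * C₀ * C₁ * τ * (2 : ℝ) ^ (-((j' : ℝ) * k / 2)) *
          ∑ j ∈ Finset.range (maxLevel δ + 1), (2 : ℝ) ^ (-((j : ℝ) * η)) * levelDecay N j j' := by
          rw [Finset.mul_sum]
          refine Finset.sum_congr rfl fun j _ => ?_
          have h5 : (2 : ℝ) ^ (-((j : ℝ) * η)) =
              (2 : ℝ) ^ (-((j : ℝ) * (η + k / 2))) * (2 : ℝ) ^ ((j : ℝ) * k / 2) := by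
            rw [← Real.rpow_add two_pos]
            congr 1
            ring
          rw [h5, Finset.sum_const, Finset.card_univ, nsmul_eq_mul]
          simp only [Fintype.card_pi, Fintype.card_bool, Finset.prod_const, Finset.card_univ,
            Fintype.card_fin]
          push_cast
          ring
      _ ≤ 2 ^ k * C₀ * C₁ * τ * (2 : ℝ) ^ (-((j' : ℝ) * k / 2)) *
          (C₂ * (2 : ℝ) ^ (-((j' : ℝ) * η))) := by
          gcongr
          exact hlev _ _
      _ = 2 ^ k * C₀ * C₁ * C₂ * τ *
          ((2 : ℝ) ^ (-((j' : ℝ) * k / 2)) * (2 : ℝ) ^ (-((j' : ℝ) * η))) := by ring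
      _ = _ := by
          rw [← Real.rpow_add two_pos, hY]
          congr 2
          ring
  rw [hsplit]
  refine (abs_sub _ _).trans ((add_le_add hfirst hsecond).trans ?_)
  have h6 : (0 : ℝ) ≤ if maxLevel δ < j' then (1 : ℝ) else 0 := by split_ifs <;> norm_num
  set ι : ℝ := if maxLevel δ < j' then (1 : ℝ) else 0
  have h7 : 0 ≤ C₀ * τ * Y := by positivity
  have h8 : 0 ≤ 2 ^ k * C₀ * C₁ * C₂ * ι * Y := by positivity
  -- The two missing cross terms are added so that a single constant multiplies `τ + ι`.
  calc _ ≤ C₀ * ι * Y + 2 ^ k * C₀ * C₁ * C₂ * τ * Y + (C₀ * τ * Y +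
        2 ^ k * C₀ * C₁ * C₂ * ι * Y) := by linarith
    _ = _ := by ring

end TruncationError

/-! ### From coefficient bounds to Besov norms -/

/-- Since `a i ^ (q - 1)` is at most `(∑ a) ^ (q - 1)`. Using the `ℓ¹` norm makes the final bound
uniform in `q₂`. -/
theorem lqNorm_le_tsum {ι : Type*} {q : ℝ≥0∞} (hq : 1 ≤ q) (a : ι → ℝ≥0∞) :
    lqNorm q a ≤ ∑' i, a i := by
  unfold lqNorm
  split_ifs with htop
  · exact iSup_le fun i => ENNReal.le_tsum i
  · have hr : 1 ≤ q.toReal := by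
      simpa using ENNReal.toReal_mono htop hq
    have h1 : ∑' i, a i ^ q.toReal ≤ (∑' i, a i) ^ q.toReal := by
      have hsplit : ∀ x : ℝ≥0∞, x ^ q.toReal = x * x ^ (q.toReal - 1) := fun x => by
        conv_rhs => rw [← ENNReal.rpow_one x, ← ENNReal.rpow_mul, one_mul]
        rw [← ENNReal.rpow_add_of_nonneg _ _ zero_le_one (by linarith), add_sub_cancel]
      calc ∑' i, a i ^ q.toReal ≤ ∑' i, a i * (∑' i, a i) ^ (q.toReal - 1) := by
            refine ENNReal.tsum_le_tsum fun i => ?_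
            rw [hsplit]
            gcongr
            exact ENNReal.le_tsum i
        _ = _ := by rw [ENNReal.tsum_mul_right, ← hsplit]
    calc _ ≤ ((∑' i, a i) ^ q.toReal) ^ (1 / q.toReal) := by
          gcongr
      _ = _ := by
        rw [← ENNReal.rpow_mul, mul_one_div_cancel (by linarith), ENNReal.rpow_one]

theorem lqNorm_finset_le {ι : Type*} (S : Finset ι) {q : ℝ≥0∞} (hq : 1 ≤ q) {u : ι → ℝ}
    {X Q : ℝ} (hX : ∀ w ∈ S, u w ≤ X) (hQ : (S.card : ℝ) ≤ Q) :
    (lqNorm q fun w : (↑S : Set ι) => ENNReal.ofReal (u w)) ≤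
      ENNReal.ofReal (Q ^ (q⁻¹).toReal * X) := by
  have hQ0 : 0 ≤ Q := (Nat.cast_nonneg _).trans hQ
  unfold lqNorm
  split_ifs with htop
  · subst htop
    simp only [ENNReal.inv_top, ENNReal.toReal_zero, Real.rpow_zero, one_mul]
    exact iSup_le fun w => ENNReal.ofReal_le_ofReal (hX w w.2)
  · have hr : 1 ≤ q.toReal := by
      simpa using ENNReal.toReal_mono htop hq
    have h1 : ∑' w : (↑S : Set ι), ENNReal.ofReal (u w) ^ q.toReal ≤
        ENNReal.ofReal Q * ENNReal.ofReal X ^ q.toReal := by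
      calc _ ≤ ∑' _w : (↑S : Set ι), ENNReal.ofReal X ^ q.toReal := by
            refine ENNReal.tsum_le_tsum fun w => ?_
            gcongr
            exact hX w w.2
        _ = (S.card : ℝ≥0∞) * ENNReal.ofReal X ^ q.toReal := by
            rw [tsum_fintype, Finset.sum_const, nsmul_eq_mul]
            simp
        _ ≤ _ := by
            gcongr
            rw [← ENNReal.ofReal_natCast]
            exact ENNReal.ofReal_le_ofReal hQ
    calc _ ≤ (ENNReal.ofReal Q * ENNReal.ofReal X ^ q.toReal) ^ (1 / q.toReal) := by
          gcongr
      _ = _ := by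
          rw [ENNReal.mul_rpow_of_nonneg _ _ (by positivity), ← ENNReal.rpow_mul,
            mul_one_div_cancel (by linarith), ENNReal.rpow_one,
            ENNReal.ofReal_rpow_of_nonneg hQ0 (by positivity),
            ← ENNReal.ofReal_mul (by positivity), ENNReal.toReal_inv, one_div]

theorem card_waveletGrid_le (k j : ℕ) {R : ℕ} (hR : 1 ≤ R) :
    ((waveletGrid k R j).card : ℝ) ≤ (3 * R * 2 ^ j : ℝ) ^ k := by
  have h1 : ((Finset.Icc (-((R : ℤ) * 2 ^ j)) ((R : ℤ) * 2 ^ j)).card : ℝ) ≤ 3 * R * 2 ^ j := by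
    rw [Int.card_Icc]
    have h2 : (1 : ℝ) ≤ R * 2 ^ j :=
      one_le_mul_of_one_le_of_one_le (by exact_mod_cast hR) (one_le_pow₀ one_le_two)
    have h3 : (((R : ℤ) * 2 ^ j + 1 - -((R : ℤ) * 2 ^ j)).toNat : ℝ) =
        (((R : ℤ) * 2 ^ j + 1 - -((R : ℤ) * 2 ^ j) : ℤ) : ℝ) := by
      exact_mod_cast Int.toNat_of_nonneg (by
        have : (0 : ℤ) ≤ R * 2 ^ j := by positivity
        linarith)
    rw [h3]
    push_cast
    linarith
  rw [waveletGrid, Fintype.card_piFinset, Finset.prod_const, Finset.card_univ, Fintype.card_fin]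
  push_cast
  gcongr

/-- Polynomially corrected geometric weights. -/
noncomputable def levelWeight (κ b : ℝ) (j : ℕ) : ℝ := (2 : ℝ) ^ (-((j : ℝ) * κ)) * (1 + j : ℝ) ^ b

theorem levelWeight_nonneg (κ b : ℝ) (j : ℕ) : 0 ≤ levelWeight κ b j := by
  unfold levelWeight
  positivity

theorem summable_levelWeight {κ b : ℝ} (hκ : 0 < κ) : Summable (levelWeight κ b) := by
  set q : ℝ := (2 : ℝ) ^ (-κ) with hq
  have hq0 : 0 < q := by positivity
  have hq1 : q < 1 := Real.rpow_lt_one_of_one_lt_of_neg one_lt_two (neg_neg_of_pos hκ)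
  have h0 := summable_pow_mul_geometric_of_norm_lt_one ⌈b⌉₊ (r := q)
    (by rwa [Real.norm_of_nonneg hq0.le])
  have h1 : Summable fun j : ℕ => ((j + 1 : ℕ) : ℝ) ^ ⌈b⌉₊ * q ^ (j + 1) :=
    (summable_nat_add_iff 1 (f := fun j : ℕ => (j : ℝ) ^ ⌈b⌉₊ * q ^ j)).2 h0
  refine Summable.of_nonneg_of_le (levelWeight_nonneg κ b) (fun j => ?_) (h1.mul_left q⁻¹)
  have h2 : (2 : ℝ) ^ (-((j : ℝ) * κ)) = q ^ j := by
    rw [hq, ← Real.rpow_natCast, ← Real.rpow_mul zero_le_two]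
    congr 1
    ring
  have h3 : (1 + j : ℝ) ^ b ≤ ((j + 1 : ℕ) : ℝ) ^ ⌈b⌉₊ := by
    rw [← Real.rpow_natCast]
    push_cast
    rw [add_comm (1 : ℝ)]
    exact Real.rpow_le_rpow_of_exponent_le (by linarith [(Nat.cast_nonneg j : (0 : ℝ) ≤ j)])
      (Nat.le_ceil b)
  rw [levelWeight, h2]
  calc _ ≤ q ^ j * ((j + 1 : ℕ) : ℝ) ^ ⌈b⌉₊ := by gcongr
    _ = _ := by rw [pow_succ]; field_simp

/-- Shift the index by `J + 1`: the exponential splits exactly, and the polynomial part through `i +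
J + 2 ≤ (1 + i) (J + 2)`. -/
theorem tsum_levelWeight_tail_le {κ b : ℝ} (hκ : 0 < κ) (hb : 0 ≤ b) (J : ℕ) :
    ∑' j, levelWeight κ b j * (if J < j then 1 else 0) ≤
      (∑' j, levelWeight κ b j) * ((J + 2 : ℝ) ^ b * (2 : ℝ) ^ (-((J + 1 : ℝ) * κ))) := by
  have hs := summable_levelWeight (b := b) hκ
  have hs2 : Summable fun j => levelWeight κ b j * (if J < j then 1 else 0) :=
    Summable.of_nonneg_of_le
      (fun j => mul_nonneg (levelWeight_nonneg κ b j) (by split_ifs <;> norm_num))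
      (fun j => mul_le_of_le_one_right (levelWeight_nonneg κ b j) (by split_ifs <;> norm_num)) hs
  rw [← hs2.sum_add_tsum_nat_add (J + 1), Finset.sum_eq_zero, zero_add, ← tsum_mul_right]
  · refine ((summable_nat_add_iff (J + 1)).2 hs2).tsum_le_tsum (fun i => ?_)
      (hs.mul_right ((J + 2 : ℝ) ^ b * (2 : ℝ) ^ (-((J + 1 : ℝ) * κ))))
    rw [if_pos (by omega), mul_one, levelWeight, levelWeight]
    have h1 : (1 + ((i + (J + 1) : ℕ) : ℝ)) ^ b ≤ (1 + i : ℝ) ^ b * (J + 2 : ℝ) ^ b := by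
      rw [← Real.mul_rpow (by positivity) (by positivity)]
      refine Real.rpow_le_rpow (by positivity) ?_ hb
      push_cast
      nlinarith [(Nat.cast_nonneg i : (0 : ℝ) ≤ i), (Nat.cast_nonneg J : (0 : ℝ) ≤ J),
        mul_nonneg (Nat.cast_nonneg i : (0 : ℝ) ≤ i) (Nat.cast_nonneg J : (0 : ℝ) ≤ J)]
    have h2 : (2 : ℝ) ^ (-(((i + (J + 1) : ℕ) : ℝ) * κ)) =
        (2 : ℝ) ^ (-((i : ℝ) * κ)) * (2 : ℝ) ^ (-((J + 1 : ℝ) * κ)) := by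
      rw [← Real.rpow_add two_pos]
      congr 1
      push_cast
      ring
    rw [h2]
    calc _ ≤ (2 : ℝ) ^ (-((i : ℝ) * κ)) * (2 : ℝ) ^ (-((J + 1 : ℝ) * κ)) *
          ((1 + i : ℝ) ^ b * (J + 2 : ℝ) ^ b) := by gcongr
      _ = _ := by ring
  · intro j hj
    rw [if_neg (by have := Finset.mem_range.1 hj; omega), mul_zero]

theorem two_rpow_neg_maxLevel_le {δ κ : ℝ} (hδ : 0 < δ) (hκ : 0 ≤ κ) :
    (2 : ℝ) ^ (-((maxLevel δ + 1 : ℝ) * κ)) ≤ δ ^ κ := by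
  have h1 : Real.logb 2 δ⁻¹ < maxLevel δ + 1 := Nat.lt_floor_add_one _
  have h2 : (2 : ℝ) ^ (-(maxLevel δ + 1 : ℝ)) ≤ δ := by
    rw [Real.rpow_neg zero_le_two]
    refine inv_le_of_inv_le₀ hδ ?_
    rw [← Real.rpow_logb two_pos (by norm_num) (inv_pos.2 hδ)]
    exact Real.rpow_le_rpow_of_exponent_le one_le_two h1.le
  rw [← neg_mul, Real.rpow_mul zero_le_two]
  exact Real.rpow_le_rpow (by positivity) h2 hκ

/-- As `δ → 1` the logarithm tends to zero while the left base stays at least `2`; hence `δ` is kept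
below `δ₀` unless `b = 0`. -/
theorem exists_maxLevel_rpow_le (b δ₀ : ℝ) (hb : 0 ≤ b) (hδ₀ : δ₀ < 1) :
    ∃ K : ℝ, 0 ≤ K ∧ ∀ δ : ℝ, 0 < δ → δ < 1 → (b = 0 ∨ δ ≤ δ₀) →
      (maxLevel δ + 2 : ℝ) ^ b ≤ K * Real.log δ⁻¹ ^ b := by
  rcases eq_or_ne b 0 with rfl | hb0
  · exact ⟨1, zero_le_one, fun δ _ _ _ => by simp⟩
  rcases le_or_gt δ₀ 0 with h0 | h0
  · exact ⟨0, le_rfl, fun δ hδ _ h => absurd (h.resolve_left hb0) (by linarith)⟩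
  have hl0 : 0 < Real.log δ₀⁻¹ := Real.log_pos (one_lt_inv₀ h0 |>.2 hδ₀)
  have hl2 : 0 < Real.log 2 := Real.log_pos one_lt_two
  -- The first term pays for `maxLevel δ`, the second for the additive `2`.
  refine ⟨(1 / Real.log 2 + 2 / Real.log δ₀⁻¹) ^ b, by positivity, fun δ hδ hδ1 h => ?_⟩
  have hle : Real.log δ₀⁻¹ ≤ Real.log δ⁻¹ :=
    Real.log_le_log (inv_pos.2 h0) (inv_anti₀ hδ (h.resolve_left hb0))
  rw [← Real.mul_rpow (by positivity) (hl0.le.trans hle)]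
  refine Real.rpow_le_rpow (by positivity) ?_ hb
  have h1 : (maxLevel δ : ℝ) ≤ Real.log δ⁻¹ / Real.log 2 :=
    Nat.floor_le (div_nonneg (hl0.le.trans hle) hl2.le)
  have h2 : 2 ≤ 2 / Real.log δ₀⁻¹ * Real.log δ⁻¹ := by
    rw [div_mul_eq_mul_div, le_div_iff₀ hl0]
    linarith
  calc (maxLevel δ + 2 : ℝ) ≤ Real.log δ⁻¹ / Real.log 2 + 2 / Real.log δ₀⁻¹ * Real.log δ⁻¹ :=
        add_le_add h1 h2
    _ = _ := by ring

/-- The grid has at most `(3 R 2 ^ j) ^ k` points, and its power `1 / q₁` cancels the `2 ^ (-j k /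
q₁)` of the Besov weight. What is left is `(3 R) ^ (k / q₁)` times a weight decaying at rate `η -
γ`; replacing `3 ^ (k / q₁)` by `3 ^ k` makes the constant uniform in `q₁`. -/
theorem besovNormBall_le_tsum {k : ℕ} {h : ℤ →₀ ℝ} {c : ℤ} {φ : ℝ → ℝ} {R : ℕ} (hR : 1 ≤ R)
    {γ b η : ℝ} {q₁ q₂ : ℝ≥0∞} (hq₁ : 1 ≤ q₁) (hq₂ : 1 ≤ q₂) {g : RR k → ℝ} {B : ℕ → ℝ}
    (hB : ∀ j, 0 ≤ B j) (hg : ∀ (j : ℕ) (ε : Fin k → Bool), ∀ w ∈ waveletGrid k R j,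
      |waveletCoeff h c φ g j ε w| ≤ B j * (2 : ℝ) ^ (-((j : ℝ) * (η + k / 2))))
    (hs : Summable fun j => levelWeight (η - γ) b j * B j) :
    besovNormBall h c φ R γ b q₁ q₂ g ≤ ENNReal.ofReal
      (2 ^ k * (3 ^ k * (R : ℝ) ^ ((k : ℝ) * (q₁⁻¹).toReal) *
        ∑' j, levelWeight (η - γ) b j * B j)) := by
  set r := (q₁⁻¹).toReal with hr
  have hr0 : 0 ≤ r := ENNReal.toReal_nonneg
  have hr1 : r ≤ 1 := by
    have := ENNReal.toReal_mono ENNReal.one_ne_top (ENNReal.inv_le_one.2 hq₁)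
    simpa [hr] using this
  have hterm : ∀ (j : ℕ) (ε : Fin k → Bool),
      ENNReal.ofReal ((2 : ℝ) ^ ((j : ℝ) * (γ + k / 2 - k * r)) * (1 + j) ^ b) *
      (lqNorm q₁ fun w : (↑(waveletGrid k R j) : Set (Fin k → ℤ)) =>
        ENNReal.ofReal |waveletCoeff h c φ g j ε w|) ≤
      ENNReal.ofReal (3 ^ k * (R : ℝ) ^ ((k : ℝ) * r) * (levelWeight (η - γ) b j * B j)) := by
    intro j ε
    have h1 := lqNorm_finset_le (waveletGrid k R j) hq₁
      (u := fun w => |waveletCoeff h c φ g j ε w|) (hg j ε)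
      (card_waveletGrid_le k j hR)
    refine (mul_le_mul_right h1 _).trans ?_
    rw [← hr, ← ENNReal.ofReal_mul (by positivity)]
    refine ENNReal.ofReal_le_ofReal ?_
    have h2 : ((3 * R * 2 ^ j : ℝ) ^ k) ^ r =
        (3 : ℝ) ^ ((k : ℝ) * r) * (R : ℝ) ^ ((k : ℝ) * r) * (2 : ℝ) ^ ((j : ℝ) * (k * r)) := by
      rw [← Real.rpow_natCast, ← Real.rpow_mul (by positivity),
        Real.mul_rpow (by positivity) (by positivity), Real.mul_rpow (by norm_num) (by positivity),
        two_rpow_nat_mul]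
    have h3 : (3 : ℝ) ^ ((k : ℝ) * r) ≤ 3 ^ k := by
      rw [← Real.rpow_natCast 3 k]
      exact Real.rpow_le_rpow_of_exponent_le (by norm_num)
        (mul_le_of_le_one_right (Nat.cast_nonneg k) hr1)
    have h4 : (2 : ℝ) ^ ((j : ℝ) * (γ + k / 2 - k * r)) * (2 : ℝ) ^ ((j : ℝ) * (k * r)) *
        (2 : ℝ) ^ (-((j : ℝ) * (η + k / 2))) = (2 : ℝ) ^ (-((j : ℝ) * (η - γ))) := by
      rw [← Real.rpow_add two_pos, ← Real.rpow_add two_pos]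
      congr 1
      ring
    have hBj := hB j
    rw [h2]
    calc _ = (3 : ℝ) ^ ((k : ℝ) * r) * (R : ℝ) ^ ((k : ℝ) * r) *
          ((2 : ℝ) ^ ((j : ℝ) * (γ + k / 2 - k * r)) * (2 : ℝ) ^ ((j : ℝ) * (k * r)) *
            (2 : ℝ) ^ (-((j : ℝ) * (η + k / 2))) * (1 + j : ℝ) ^ b * B j) := by ring
      _ = (3 : ℝ) ^ ((k : ℝ) * r) * (R : ℝ) ^ ((k : ℝ) * r) *
          (levelWeight (η - γ) b j * B j) := by rw [h4, levelWeight]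
      _ ≤ _ := by
          have := mul_nonneg (levelWeight_nonneg (η - γ) b j) hBj
          gcongr
  set D : ℝ := 3 ^ k * (R : ℝ) ^ ((k : ℝ) * r) with hD
  have hD0 : 0 ≤ D := by positivity
  set y : ℕ → ℝ := fun j => levelWeight (η - γ) b j * B j with hy
  have hy0 : ∀ j, 0 ≤ y j := fun j => mul_nonneg (levelWeight_nonneg _ _ _) (hB j)
  have hsum : ∑' j, ENNReal.ofReal (D * y j) = ENNReal.ofReal (D * ∑' j, y j) := by
    rw [← tsum_mul_left, ENNReal.ofReal_tsum_of_nonneg (fun j => mul_nonneg hD0 (hy0 j))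
      (hs.mul_left D)]
  calc _ ≤ ∑' p : ℕ × (Fin k → Bool), ENNReal.ofReal (D * y p.1) :=
        (lqNorm_le_tsum hq₂ _).trans (ENNReal.tsum_le_tsum fun p => hterm p.1 p.2)
    _ = ∑' (j : ℕ) (_ε : Fin k → Bool), ENNReal.ofReal (D * y j) :=
        ENNReal.tsum_prod (f := fun (j : ℕ) (_ : Fin k → Bool) => ENNReal.ofReal (D * y j))
    _ = ∑' j : ℕ, (2 ^ k : ℝ≥0∞) * ENNReal.ofReal (D * y j) := by
        refine tsum_congr fun j => ?_
        rw [tsum_fintype, Finset.sum_const, Finset.card_univ, Fintype.card_fun, Fintype.card_bool,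
          Fintype.card_fin, nsmul_eq_mul]
        push_cast
        rfl
    _ = _ := by
        rw [ENNReal.tsum_mul_left, hsum, ENNReal.ofReal_mul (p := 2 ^ k) (by positivity),
          ENNReal.ofReal_pow zero_le_two, ENNReal.ofReal_ofNat]

/-! ### Assembly of the proposition -/

theorem InHolderBall.mono {k : ℕ} {η K K' : ℝ} {f : RR k → ℝ} (hf : InHolderBall η K f)
    (h : K ≤ K') : InHolderBall η K' f := by
  obtain ⟨hc, D, h0, h1, h2, h3⟩ := hf
  exact ⟨hc, D, h0, h1, h2, h3.trans (ENNReal.ofReal_le_ofReal h)⟩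

theorem mainTheorem10
    (d k : ℕ) (hk : 0 < k) (η : ℝ) (hη : 0 < η) (hηd : η ≤ (d : ℝ) / 2)
    (h : ℤ →₀ ℝ) (c : ℤ) (φ : ℝ → ℝ) (hφ : IsScalingFunction h φ)
    (hφreg : ∃ A : ℝ, InHolderBallReal ((d : ℝ) / 2 + 2) A φ) :
    -- an admissible constant `Cη` in the definition of the class exists
    (∃ Cη : ℝ, 0 < Cη ∧ HolderInBesov k h c φ η Cη) ∧
    -- the truncated expansion belongs to the class
    (∀ Cη : ℝ, 0 < Cη → HolderInBesov k h c φ η Cη →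
      ∀ K : ℝ, 1 < K → ∀ (n : ℕ) (S : ℝ) (φ' : ℝ → ℝ), 1 ≤ n → IsApproxScaling d n S φ φ' →
      ∀ (R : ℕ) (δ : ℝ), 1 ≤ R → 0 < δ → δ < 1 →
      ∀ f : RR k → ℝ, InHolderBall η 1 f →
        truncExpansion h c φ φ' δ R f ∈ approxClass k h c φ' η Cη K δ R) ∧
    -- the approximation bound
    (∀ γ b S δ₀ : ℝ, γ < η → 0 ≤ b → δ₀ < 1 →
      ∃ C : ℝ, ∀ (n : ℕ) (φ' : ℝ → ℝ), 1 ≤ n → IsApproxScaling d n S φ φ' →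
      ∀ (R : ℕ) (δ : ℝ), 1 ≤ R → 0 < δ → δ < 1 → (b = 0 ∨ δ ≤ δ₀) →
      ∀ f : RR k → ℝ, InHolderBall η 1 f →
      ∀ q₁ q₂ : ENNReal, 1 ≤ q₁ → 1 ≤ q₂ →
        besovNormBall h c φ R γ b q₁ q₂ (fun x => f x - truncExpansion h c φ φ' δ R f x) ≤
          ENNReal.ofReal (C * (R : ℝ) ^ ((k : ℝ) * (q₁⁻¹).toReal) *
            ((n : ℝ) ^ (-(1 / 2) : ℝ) + Real.log δ⁻¹ ^ b * δ ^ (η - γ)))) := by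
  obtain ⟨A, hA⟩ := hφreg
  set N : ℕ := d / 2 + 2 with hNdef
  have hfloor : ⌊(d : ℝ) / 2 + 2⌋₊ = N := by
    rw [Nat.floor_add_ofNat (by positivity)]
    congr 1
    exact_mod_cast Nat.floor_div_natCast (d : ℝ) 2 |>.trans (by simp)
  -- Halving `d` in the integers loses at most `1 / 2`, so `N ≥ d / 2 + 3 / 2 > η + 1`. This
  -- provides both the `⌊η⌋ + 1` moments and the gap `η < N`.
  have hNη : η + 1 < N := by
    have h1 : (d : ℝ) ≤ 2 * (d / 2 : ℕ) + 1 := by exact_mod_cast (by omega : d ≤ 2 * (d / 2) + 1)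
    rw [hNdef]
    push_cast
    linarith
  have hA' : InHolderBallReal ((d : ℝ) / 2 + 2) |A| φ := InHolderBall.mono hA (le_abs_self A)
  have hdual : ∀ l ≤ N, MomentDual l l |A| φ := fun l hl =>
    hA'.momentDual (abs_nonneg A) (by rwa [hfloor])
  have hψ : VanishingMoments N (motherWavelet h c φ) :=
    hφ.vanishingMoments c (abs_nonneg A) hdual
  have hψη : VanishingMoments (⌊η⌋₊ + 1) (motherWavelet h c φ) := by
    refine hψ.mono ?_
    have h1 := Nat.floor_le hη.le
    have h2 : ((⌊η⌋₊ + 1 : ℕ) : ℝ) < N := by push_cast; linarith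
    exact_mod_cast h2.le
  obtain ⟨C₀, hC₀, hcoeff⟩ := exists_abs_waveletCoeff_le hφ c hk hη.le hψη
  refine ⟨⟨C₀, hC₀, holderInBesov_of_abs_waveletCoeff_le hcoeff⟩, ?_, ?_⟩
  · intro Cη hCη hadm K hK n S φ' _ _ R δ _ _ _ f hf
    exact truncExpansion_mem_approxClass hCη.le hadm hK.le hf φ' δ R
  intro γ b S δ₀ hγ hb hδ₀
  obtain ⟨T₀, hT₀, hφT₀⟩ := exists_radius_of_hasCompactSupport hφ.hasCompactSupport
  -- A common support radius for `φ` and all approximations, so that constants depend on `S` but not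
  -- on `n` or `φ'`.
  set T : ℝ := max T₀ S with hT
  have hT0 : 0 < T := hT₀.trans_le (le_max_left _ _)
  have hφT : ∀ x, T < |x| → φ x = 0 := fun x hx => hφT₀ x ((le_max_left _ _).trans_lt hx)
  have hφp : IsProfile N T |A| φ :=
    ⟨hφ.continuous, hA'.abs_le (abs_nonneg A), hφT, hdual N le_rfl⟩
  obtain ⟨C₁, hC₁, herr⟩ := hφ.exists_abs_waveletCoeff_error_le c hψ hT0 hφp hη
    (by linarith) hC₀ hcoeff
  obtain ⟨K, hK, hlevel⟩ := exists_maxLevel_rpow_le b δ₀ hb hδ₀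
  have hκ : 0 < η - γ := sub_pos.2 hγ
  set Z := ∑' j, levelWeight (η - γ) b j with hZ
  have hZ0 : 0 ≤ Z := tsum_nonneg fun j => levelWeight_nonneg _ _ _
  -- Here `2 ^ k` counts the `ε`, `3 ^ k` comes from the grid size, `C₁` from the coefficient bound,
  -- `Z` from the sum over levels, and `K` from comparing the last level with the logarithm.
  refine ⟨2 ^ k * 3 ^ k * C₁ * Z * (1 + K), fun n φ' hn hφ' R δ hR hδ hδ1 hδ₀' f hf q₁ q₂ hq₁ hq₂ =>
    ?_⟩
  set τ : ℝ := (n : ℝ) ^ (-(1 / 2) : ℝ) with hτ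
  have hτ0 : 0 ≤ τ := by positivity
  have hτ1 : τ ≤ 1 :=
    Real.rpow_le_one_of_one_le_of_nonpos (by exact_mod_cast hn) (by norm_num)
  have hclose := hφ'.close
  have hcont' : Continuous φ' := by
    convert hφ.continuous.sub hclose.continuous using 1
    ext x
    simp
  have hp : IsProfile N T τ (fun x => φ x - φ' x) := by
    refine ⟨hclose.continuous, hclose.abs_le hτ0, fun x hx => ?_,
      hclose.momentDual hτ0 (by rw [Nat.floor_natCast])⟩
    rw [hφT x hx, hφ'.support x ((le_max_right _ _).trans_lt hx), sub_zero]
  set B : ℕ → ℝ := fun j => C₁ * (τ + if maxLevel δ < j then 1 else 0) with hB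
  have hι0 : ∀ j : ℕ, (0 : ℝ) ≤ if maxLevel δ < j then 1 else 0 := fun j => by
    split_ifs <;> norm_num
  have hι1 : ∀ j : ℕ, (if maxLevel δ < j then (1 : ℝ) else 0) ≤ 1 := fun j => by
    split_ifs <;> norm_num
  have hB0 : ∀ j, 0 ≤ B j := fun j => mul_nonneg hC₁.le (add_nonneg hτ0 (hι0 j))
  have hsw := summable_levelWeight (b := b) hκ
  have hsι : Summable fun j => levelWeight (η - γ) b j * (if maxLevel δ < j then 1 else 0) :=
    Summable.of_nonneg_of_le (fun j => mul_nonneg (levelWeight_nonneg _ _ _) (hι0 j))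
      (fun j => mul_le_of_le_one_right (levelWeight_nonneg _ _ _) (hι1 j)) hsw
  have hexp : (fun j => levelWeight (η - γ) b j * B j) = fun j =>
      C₁ * (levelWeight (η - γ) b j * τ +
        levelWeight (η - γ) b j * (if maxLevel δ < j then 1 else 0)) := by
    funext j
    simp only [hB]
    ring
  have hsB : Summable fun j => levelWeight (η - γ) b j * B j := by
    rw [hexp]
    exact ((hsw.mul_right τ).add hsι).mul_left C₁
  refine (besovNormBall_le_tsum hR hq₁ hq₂ hB0
    (herr τ φ' hτ1 hcont' hp R δ f hf) hsB).trans (ENNReal.ofReal_le_ofReal ?_)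
  have hlog : 0 ≤ Real.log δ⁻¹ ^ b :=
    Real.rpow_nonneg (Real.log_nonneg (one_le_inv₀ hδ |>.2 hδ1.le)) b
  have hδκ : 0 ≤ δ ^ (η - γ) := by positivity
  have htail : ∑' j, levelWeight (η - γ) b j * (if maxLevel δ < j then 1 else 0) ≤
      Z * (K * Real.log δ⁻¹ ^ b * δ ^ (η - γ)) := by
    refine (tsum_levelWeight_tail_le hκ hb (maxLevel δ)).trans ?_
    have h1 := hlevel δ hδ hδ1 hδ₀'
    have h2 := two_rpow_neg_maxLevel_le hδ hκ.le
    gcongr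
  have htsum : ∑' j, levelWeight (η - γ) b j * B j ≤
      C₁ * (Z * τ + Z * (K * Real.log δ⁻¹ ^ b * δ ^ (η - γ))) := by
    rw [hexp, tsum_mul_left, (hsw.mul_right τ).tsum_add hsι, tsum_mul_right]
    gcongr
  set Rk : ℝ := (R : ℝ) ^ ((k : ℝ) * (q₁⁻¹).toReal)
  have hRk : 0 ≤ Rk := by positivity
  set L : ℝ := Real.log δ⁻¹ ^ b * δ ^ (η - γ) with hL
  have hL0 : 0 ≤ L := mul_nonneg hlog hδκ
  calc _ ≤ 2 ^ k * (3 ^ k * Rk * (C₁ * (Z * τ + Z * (K * Real.log δ⁻¹ ^ b * δ ^ (η - γ))))) := by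
        gcongr
    _ = 2 ^ k * 3 ^ k * C₁ * Z * Rk * (τ + K * L) := by rw [hL]; ring
    _ ≤ 2 ^ k * 3 ^ k * C₁ * Z * Rk * ((1 + K) * (τ + L)) := by
        gcongr
        nlinarith [mul_nonneg hK hτ0]
    _ = _ := by ring
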